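/- **Conventions.** All vector lattices are real and Archimedean; $\mathbb{N}=\{1,2,\dots\}$, $\mathbb{R}^+=[0,\infty)$. For $m\in\mathbb{N}$ let $\mathcal{H}(\mathbb{R}^m)$ be the set of continuous $h:\mathbb{R}^m\to\mathbb{R}$ with $h(\lambda x)=\lambda h(x)$ for all $\lambda\in\mathbb{R}^+$, $x\in\mathbb{R}^m$. Such an $h$ is *absolutely invariant* if $h(x_1,\dots,x_m)=h(|x_1|,\dots,|x_m|)$ for all real $x_1,\dots,x_m$. For $a_1,\dots,a_m,b$ in a vector lattice $E$, write $h(a_1,\dots,a_m)=b$ if $h(\omega(a_1),\dots,\omega(a_m))=\omega(b)$ for every nonzero real-valued vector lattice homomorphism $\omega$ on the vector sublattice of $E$ generated by $a_1,\dots,a_m,b$. For $\mathcal{D}\subseteq\bigcup_{m\in\mathbb{N}}\mathcal{H}(\mathbb{R}^m)$, $E$ is *$\mathcal{D}$-complete* if for all $h\in\mathcal{D}\cap\mathcal{H}(\mathbb{R}^m)$ and $a_1,\dots,a_m\in E$ there is $b\in E$ with $h(a_1,\dots,a_m)=b$. A sequence $(f_n)$ in $E$ *converges relatively uniformly* to $f$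 if there is $p>0$ in $E$ such that for every real $\epsilon>0$ one has $|f_n-f|<\epsilon p$ for all large $n$; it is *relatively uniformly Cauchy* if there is $p>0$ in $E$ such that for every real $\epsilon>0$ one has $|f_m-f_n|<\epsilon p$ for all large $m,n$; $E$ is *uniformly complete* if every relatively uniformly Cauchy sequence in $E$ converges relatively uniformly in $E$. A *uniform completion* of $E$ is a pair $(E^u,\phi)$ of a uniformly complete Archimedean vector lattice $E^u$ and an injective vector lattice homomorphism $\phi:E\to E^u$ such that every vector lattice homomorphism $T$ from $E$ to a uniformly complete Archimedean vector lattice $H$ has the form $T=T^u\circ\phi$ for a unique vector lattice homomorphism $T^u:E^u\to H$. Given $(E^u,\phi)$ and $\mathcal{D}$, let $E_{(1)}=\phi(E)$, let $E_{(n+1)}$ be the vector sublattice of $E^u$ generated by $E_{(n)}$ together with all elements $h(a_1,\dots,a_m)$ of $E^u$ with $h\in\mathcal{D}\cap\mathcal{H}(\mathbb{R}^m)$ and $a_1,\dots,a_m\in E_{(n)}$, and put $E^{\mathcal{D}}=\bigcup_{n\in\mathbb{N}} E_{(n)}$. A map $T:E_1\times\dots\times E_s\to F$ between vector lattices is a *vector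 lattice $s$-morphism* if it is linear in each variable and, for each $k$, the map $f_k\mapsto T(f_1,\dots,f_s)$ is a vector lattice homomorphism whenever $f_j\ge 0$ for all $j\ne k$. **Theorem 3.18.** Let $s\in\mathbb{N}$, let $E_1,\dots,E_s,F$ be Archimedean vector lattices, let $\mathcal{D}\subseteq\bigcup_{m\in\mathbb{N}}\mathcal{H}(\mathbb{R}^m)$ be nonempty, let $F$ be $\mathcal{D}$-complete, and let $T:E_1\times\dots\times E_s\to F$ be a vector lattice $s$-morphism. Then every $E_k$ has a uniform completion, and for any uniform completions $(E_k^u,\phi_k)$ of $E_k$ $(k=1,\dots,s)$, with $E_k^{\mathcal{D}}\subseteq E_k^u$ as above, the following hold. 1. If all elements of $\mathcal{D}$ are absolutely invariant, then there is a unique vector lattice $s$-morphism $T^{\mathcal{D}}:E_1^{\mathcal{D}}\times\dots\times E_s^{\mathcal{D}}\to F$ such that $T^{\mathcal{D}}(\phi_1(f_1),\dots,\phi_s(f_s))=T(f_1,\dots,f_s)$ for all $f_k\in E_k$ $(k=1,\dots,s)$. 2. If $s=1$, then the conclusion of (1) holds without assuming that the elements of $\mathcal{D}$ are absolutely invariant.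 -/

import Mathlib

universe u v

/-! Archimedean vector lattices and their homomorphisms -/

/-- A lattice-ordered real vector space that is Archimedean in the sense of vector lattice theory:
if `0 ≤ x` and `n x ≤ y` for all `n`, then `x = 0`.
(Mathlib's `Archimedean` is the stronger notion for which each positive element is a
strong unit, and is not what is meant here.) -/
class ArchimedeanVectorLattice (E : Type u) [AddCommGroup E] [Lattice E] [Module ℝ E] : Prop
    extends IsOrderedAddMonoid E, PosSMulMono ℝ E where
  eq_zero_of_nsmul_le : ∀ x y : E, 0 ≤ x → (∀ n : ℕ, n • x ≤ y) → x = 0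

/-- A linear map preserving binary suprema and infima. -/
def IsLatticeHom {E : Type u} {F : Type v} [AddCommGroup E] [Lattice E] [Module ℝ E]
    [AddCommGroup F] [Lattice F] [Module ℝ F] (T : E →ₗ[ℝ] F) : Prop :=
  ∀ x y : E, T (x ⊔ y) = T x ⊔ T y ∧ T (x ⊓ y) = T x ⊓ T y

/-- Vector lattice homomorphisms. -/
structure VLHom (E : Type u) (F : Type v) [AddCommGroup E] [Lattice E] [Module ℝ E]
    [AddCommGroup F] [Lattice F] [Module ℝ F] where
  toLin : E →ₗ[ℝ] F
  isLatticeHom : IsLatticeHom toLin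

instance {E : Type u} {F : Type v} [AddCommGroup E] [Lattice E] [Module ℝ E]
    [AddCommGroup F] [Lattice F] [Module ℝ F] : FunLike (VLHom E F) E F where
  coe T := T.toLin
  coe_injective := by
    rintro ⟨S, hS⟩ ⟨T, hT⟩ h
    have : S = T := DFunLike.coe_injective h
    subst this
    rfl

/-- An `s`-linear map that is a vector lattice homomorphism in each variable whenever all the
other variables are fixed at positive elements. -/
def IsVLMultimorphism {s : ℕ} {E : Fin s → Type u} {F : Type v}
    [∀ k, AddCommGroup (E k)] [∀ k, Lattice (E k)] [∀ k, Module ℝ (E k)]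
    [AddCommGroup F] [Lattice F] [Module ℝ F] (T : MultilinearMap ℝ E F) : Prop :=
  ∀ (k : Fin s) (f : ∀ j, E j), (∀ j, j ≠ k → 0 ≤ f j) → IsLatticeHom (T.toLinearMap f k)

/-! Vector sublattices -/

/-- A linear subspace closed under binary suprema and infima. -/
structure VectorSublattice (E : Type u) [AddCommGroup E] [Lattice E] [Module ℝ E]
    extends Submodule ℝ E where
  sup_mem' : ∀ {x y : E}, x ∈ carrier → y ∈ carrier → x ⊔ y ∈ carrier
  inf_mem' : ∀ {x y : E}, x ∈ carrier → y ∈ carrier → x ⊓ y ∈ carrier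

namespace VectorSublattice

variable {E : Type u} [AddCommGroup E] [Lattice E] [Module ℝ E]

instance : SetLike (VectorSublattice E) E where
  coe L := L.carrier
  coe_injective := by
    rintro ⟨L, _, _⟩ ⟨M, _, _⟩ h
    have : L = M := SetLike.coe_injective h
    subst this
    rfl

instance : AddSubgroupClass (VectorSublattice E) E where
  add_mem {L _ _} hx hy := L.toSubmodule.add_mem hx hy
  zero_mem L := L.toSubmodule.zero_mem
  neg_mem {L _} hx := L.toSubmodule.neg_mem hx

instance : SMulMemClass (VectorSublattice E) ℝ E where
  smul_mem {L} r _ hx := L.toSubmodule.smul_mem r hx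

/-- The lattice operations of a vector sublattice are those of the ambient space. -/
instance (L : VectorSublattice E) : Lattice L :=
  Subtype.lattice (fun _ _ hx hy => L.sup_mem' hx hy) (fun _ _ hx hy => L.inf_mem' hx hy)

instance (L : VectorSublattice E) [ArchimedeanVectorLattice E] : ArchimedeanVectorLattice L where
  add_le_add_left a b h c := by
    change (a : E) + c ≤ b + c
    exact add_le_add_left (show (a : E) ≤ b from h) c
  smul_le_smul_of_nonneg_left r hr a b h := by
    change r • (a : E) ≤ r • (b : E)
    exact smul_le_smul_of_nonneg_left (show (a : E) ≤ b from h) hr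
  eq_zero_of_nsmul_le x y hx h :=
    Subtype.ext (ArchimedeanVectorLattice.eq_zero_of_nsmul_le (x : E) y hx h)

/-- The vector sublattice generated by a set: the intersection of all those containing it. -/
def generated (A : Set E) : VectorSublattice E where
  carrier := {x | ∀ L : VectorSublattice E, A ⊆ L → x ∈ L}
  add_mem' hx hy L hL := add_mem (hx L hL) (hy L hL)
  zero_mem' L _ := zero_mem L
  smul_mem' r _ hx L hL := SMulMemClass.smul_mem r (hx L hL)
  sup_mem' hx hy L hL := L.sup_mem' (hx L hL) (hy L hL)
  inf_mem' hx hy L hL := L.inf_mem' (hx L hL) (hy L hL)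

theorem subset_generated (A : Set E) : A ⊆ generated A :=
  fun _ hx _ hL => hL hx

end VectorSublattice

/-- The image of a vector lattice homomorphism. -/
def VLHom.range {E : Type u} {F : Type v} [AddCommGroup E] [Lattice E] [Module ℝ E]
    [AddCommGroup F] [Lattice F] [Module ℝ F] (T : VLHom E F) : VectorSublattice F where
  toSubmodule := LinearMap.range T.toLin
  sup_mem' := by
    rintro _ _ ⟨x, rfl⟩ ⟨y, rfl⟩
    exact ⟨x ⊔ y, (T.isLatticeHom x y).1⟩
  inf_mem' := by
    rintro _ _ ⟨x, rfl⟩ ⟨y, rfl⟩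
    exact ⟨x ⊓ y, (T.isLatticeHom x y).2⟩

/-! Relatively uniform convergence and uniform completions -/

section RelativelyUniform

variable {E : Type u} [AddCommGroup E] [Lattice E] [Module ℝ E]

def RUConverges (f : ℕ → E) (g : E) : Prop :=
  ∃ p : E, 0 < p ∧ ∀ ε : ℝ, 0 < ε → ∃ N : ℕ, ∀ n, N ≤ n → |f n - g| < ε • p

def RUCauchy (f : ℕ → E) : Prop :=
  ∃ p : E, 0 < p ∧ ∀ ε : ℝ, 0 < ε → ∃ N : ℕ, ∀ m n, N ≤ m → N ≤ n → |f m - f n| < ε • p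

end RelativelyUniform

def IsUniformlyComplete (E : Type u) [AddCommGroup E] [Lattice E] [Module ℝ E] : Prop :=
  ∀ f : ℕ → E, RUCauchy f → ∃ g : E, RUConverges f g

/-- `(G, φ)` is a uniform completion of `E`. -/
structure IsUniformCompletion {E G : Type u} [AddCommGroup E] [Lattice E] [Module ℝ E]
    [AddCommGroup G] [Lattice G] [Module ℝ G] (φ : VLHom E G) : Prop where
  archimedean : ArchimedeanVectorLattice G
  uniformlyComplete : IsUniformlyComplete G
  injective : Function.Injective φ
  existsUnique_extension : ∀ (H : Type u) [AddCommGroup H] [Lattice H] [Module ℝ H]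
    [ArchimedeanVectorLattice H], IsUniformlyComplete H →
    ∀ T : VLHom E H, ∃! S : VLHom G H, ∀ x : E, S (φ x) = T x

/-! Functional calculus -/

/-- Continuous, positively homogeneous real functions on `ℝ^m`. -/
structure PosHomFun (m : ℕ) where
  toFun : (Fin m → ℝ) → ℝ
  continuous_toFun : Continuous toFun
  map_smul : ∀ (r : ℝ) (x : Fin m → ℝ), 0 ≤ r → toFun (r • x) = r * toFun x

/-- `h(x₁, …, xₘ) = h(|x₁|, …, |xₘ|)` for all real `x₁, …, xₘ`. -/
def PosHomFun.AbsolutelyInvariant {m : ℕ} (h : PosHomFun m) : Prop :=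
  ∀ x : Fin m → ℝ, h.toFun x = h.toFun (fun i => |x i|)

/-- The disjoint union, over the integers `m ≥ 1`, of the spaces of continuous positively
homogeneous functions on `ℝ^m`. -/
abbrev AnyPosHomFun : Type := Σ m : ℕ+, PosHomFun m

/-- The relation `h(a₁, …, aₘ) = b` in `E`: it holds under every nonzero real-valued vector
lattice homomorphism on the vector sublattice generated by `a₁, …, aₘ, b`. -/
def HasValue {E : Type u} [AddCommGroup E] [Lattice E] [Module ℝ E] {m : ℕ}
    (h : PosHomFun m) (a : Fin m → E) (b : E) : Prop :=
  ∀ ω : VLHom (VectorSublattice.generated (insert b (Set.range a))) ℝ,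
    (∃ x, ω x ≠ 0) →
    h.toFun (fun i => ω ⟨a i, VectorSublattice.subset_generated _ (Or.inr ⟨i, rfl⟩)⟩) =
      ω ⟨b, VectorSublattice.subset_generated _ (Or.inl rfl)⟩

/-- `E` is `D`-complete: `h(a₁, …, aₘ)` exists in `E` for all `h ∈ D` and `a₁, …, aₘ ∈ E`. -/
def IsFunctionallyComplete (D : Set AnyPosHomFun) (E : Type u) [AddCommGroup E] [Lattice E]
    [Module ℝ E] : Prop :=
  ∀ h ∈ D, ∀ a : Fin h.1 → E, ∃ b : E, HasValue h.2 a b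

/-! The `D`-completion inside a uniform completion -/

section Completion

variable {E : Type u} {G : Type v} [AddCommGroup E] [Lattice E] [Module ℝ E]
  [AddCommGroup G] [Lattice G] [Module ℝ G]

/-- Stage `0` is `φ(E)`; stage `n + 1` is the vector sublattice generated by stage `n` and all the
elements `h(a₁, …, aₘ)` with `h ∈ D` and `a₁, …, aₘ` in stage `n`. -/
def completionStage (D : Set AnyPosHomFun) (φ : VLHom E G) : ℕ → VectorSublattice G
  | 0 => φ.range
  | n + 1 => VectorSublattice.generated
      ((completionStage D φ n : Set G) ∪
        {b | ∃ h ∈ D, ∃ a : Fin h.1 → G,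
          (∀ i, a i ∈ completionStage D φ n) ∧ HasValue h.2 a b})

theorem completionStage_mono (D : Set AnyPosHomFun) (φ : VLHom E G) {n m : ℕ} (hnm : n ≤ m)
    {x : G} (hx : x ∈ completionStage D φ n) : x ∈ completionStage D φ m := by
  induction hnm with
  | refl => exact hx
  | step _ ih => exact VectorSublattice.subset_generated _ (Or.inl ih)

/-- The union of the stages; for `φ` the embedding of `E` into its uniform completion this is
the space `E^D`. -/
def functionalCompletion (D : Set AnyPosHomFun) (φ : VLHom E G) : VectorSublattice G where
  carrier := {x | ∃ n, x ∈ completionStage D φ n}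
  add_mem' := by
    rintro x y ⟨n, hn⟩ ⟨m, hm⟩
    exact ⟨max n m, add_mem (completionStage_mono D φ (le_max_left n m) hn)
      (completionStage_mono D φ (le_max_right n m) hm)⟩
  zero_mem' := ⟨0, zero_mem _⟩
  smul_mem' := by
    rintro r x ⟨n, hn⟩
    exact ⟨n, SMulMemClass.smul_mem r hn⟩
  sup_mem' := by
    rintro x y ⟨n, hn⟩ ⟨m, hm⟩
    exact ⟨max n m, (completionStage D φ (max n m)).sup_mem'
      (completionStage_mono D φ (le_max_left n m) hn)
      (completionStage_mono D φ (le_max_right n m) hm)⟩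
  inf_mem' := by
    rintro x y ⟨n, hn⟩ ⟨m, hm⟩
    exact ⟨max n m, (completionStage D φ (max n m)).inf_mem'
      (completionStage_mono D φ (le_max_left n m) hn)
      (completionStage_mono D φ (le_max_right n m) hm)⟩

/-- The map `φ`, regarded as a map from `E` into the functional completion. -/
def toFunctionalCompletion (D : Set AnyPosHomFun) (φ : VLHom E G) (x : E) :
    functionalCompletion D φ :=
  ⟨φ x, 0, x, rfl⟩

end Completion

open Filter

/-! There may be no nonzero real homomorphism on a vector lattice `E`, but every countable subset of
a nonzero `E` lies in a sublattice with enough of them. Hence `E` embeds, by evaluation, into the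
germs of real functions along the filter generated by the sets of functions on `E` that are
homomorphisms on a countably generated sublattice. This algebra of germs is uniformly complete and
carries the functional calculus pointwise, so that `E^D` is represented by germs as well, and a
homomorphism defined on `E` extends to germs by composition.

For a multimorphism `T` and `0 ≤ f ≤ e`, two slices of `T` at `f` and at `e` are proportional at
every real homomorphism, because one is dominated by the other. Multiplying up the factors gives
`T f = T e * ∏ k, T (e with f k at place k) / T e` in germs, where the junk value `x / 0 = 0` is the
right one. The right-hand side involves only slices, which are homomorphisms and therefore extend to
`E^D`; and it does not depend on `e` as soon as `e` dominates `f`. That the extension takes its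
values in `F` rather than in germs follows one variable at a time from the `D`-completeness of `F`.
-/

section Order

variable {E : Type*} [AddCommGroup E] [Lattice E]

theorem abs_eq_zero_iff_of_lattice [IsOrderedAddMonoid E] {x : E} : |x| = 0 ↔ x = 0 := by
  refine ⟨fun h => ?_, fun h => by rw [h, abs_zero]⟩
  exact le_antisymm ((le_abs_self x).trans h.le) (neg_nonpos.1 ((neg_le_abs x).trans h.le))

variable [Module ℝ E] [PosSMulMono ℝ E]

theorem smul_sup_of_nonneg {r : ℝ} (hr : 0 ≤ r) (x y : E) : r • (x ⊔ y) = r • x ⊔ r • y := by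
  rcases hr.eq_or_lt with rfl | hr
  · simp only [zero_smul, sup_idem]
  · exact (OrderIso.smulRight hr).map_sup x y

theorem smul_inf_of_nonneg {r : ℝ} (hr : 0 ≤ r) (x y : E) : r • (x ⊓ y) = r • x ⊓ r • y := by
  rcases hr.eq_or_lt with rfl | hr
  · simp only [zero_smul, inf_idem]
  · exact (OrderIso.smulRight hr).map_inf x y

theorem abs_smul_of_nonneg {r : ℝ} (hr : 0 ≤ r) (x : E) : |r • x| = r • |x| := by
  rw [abs, abs, smul_sup_of_nonneg hr, smul_neg]

theorem abs_smul_of_lattice (r : ℝ) (x : E) : |r • x| = |r| • |x| := by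
  rcases le_total 0 r with hr | hr
  · rw [abs_of_nonneg hr, abs_smul_of_nonneg hr]
  · rw [abs_of_nonpos hr, ← abs_smul_of_nonneg (neg_nonneg.2 hr), neg_smul, abs_neg]

theorem smul_inf_smul_eq_zero [IsOrderedAddMonoid E] {x y : E} (hx : 0 ≤ x) (hy : 0 ≤ y)
    (hxy : x ⊓ y = 0) {r t : ℝ} (hr : 0 ≤ r) (ht : 0 ≤ t) : r • x ⊓ t • y = 0 := by
  refine le_antisymm ?_ (le_inf (smul_nonneg hr hx) (smul_nonneg ht hy))
  calc r • x ⊓ t • y ≤ max r t • x ⊓ max r t • y :=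
        inf_le_inf (smul_le_smul_of_nonneg_right (le_max_left r t) hx)
          (smul_le_smul_of_nonneg_right (le_max_right r t) hy)
    _ = 0 := by rw [← smul_inf_of_nonneg (hr.trans (le_max_left r t)), hxy, smul_zero]

end Order

namespace ArchimedeanVectorLattice

variable {E : Type*} [AddCommGroup E] [Lattice E] [Module ℝ E] [ArchimedeanVectorLattice E]

theorem eq_zero_of_forall_le_smul {x p : E} (hx : 0 ≤ x) (h : ∀ ε : ℝ, 0 < ε → x ≤ ε • p) :
    x = 0 := by
  have hp : 0 ≤ p := by simpa only [one_smul] using hx.trans (h 1 one_pos)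
  refine eq_zero_of_nsmul_le x p hx fun n => ?_
  rcases n.eq_zero_or_pos with rfl | hn
  · simpa only [zero_nsmul] using hp
  · have hn : (0 : ℝ) < n := Nat.cast_pos.2 hn
    calc n • x = (n : ℝ) • x := (Nat.cast_smul_eq_nsmul ℝ n x).symm
      _ ≤ (n : ℝ) • ((n : ℝ)⁻¹ • p) := smul_le_smul_of_nonneg_left (h _ (inv_pos.2 hn)) hn.le
      _ = p := smul_inv_smul₀ hn.ne' p

theorem le_of_forall_le_add_smul {x y p : E} (h : ∀ ε : ℝ, 0 < ε → x ≤ y + ε • p) : x ≤ y := by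
  have : (x - y) ⊔ 0 = 0 := by
    refine eq_zero_of_forall_le_smul (p := p ⊔ 0) le_sup_right fun ε hε => sup_le ?_ ?_
    · rw [sub_le_iff_le_add']
      exact (h ε hε).trans
        (add_le_add_right (smul_le_smul_of_nonneg_left le_sup_left hε.le) _)
    · exact smul_nonneg hε.le le_sup_right
  exact sub_nonpos.1 (sup_eq_right.1 this)

end ArchimedeanVectorLattice

/-! ### Sublattices and the homomorphisms defined on them -/

namespace VectorSublattice

variable {E R : Type*} [AddCommGroup E] [Lattice E] [Module ℝ E]

theorem sup_mem (L : VectorSublattice E) {x y : E} (hx : x ∈ L) (hy : y ∈ L) : x ⊔ y ∈ L :=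
  L.sup_mem' hx hy

theorem inf_mem (L : VectorSublattice E) {x y : E} (hx : x ∈ L) (hy : y ∈ L) : x ⊓ y ∈ L :=
  L.inf_mem' hx hy

theorem abs_mem (L : VectorSublattice E) {x : E} (hx : x ∈ L) : |x| ∈ L :=
  L.sup_mem hx (neg_mem hx)

theorem generated_subset {A : Set E} {L : VectorSublattice E} (h : A ⊆ L) :
    (generated A : Set E) ⊆ L :=
  fun _ hx => hx L h

theorem generated_mono {A B : Set E} (h : A ⊆ B) : (generated A : Set E) ⊆ generated B :=
  generated_subset (h.trans (subset_generated B))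

/-- The whole space, as a vector sublattice of itself. -/
instance : Top (VectorSublattice E) where
  top :=
    { toSubmodule := ⊤
      sup_mem' := fun _ _ => trivial
      inf_mem' := fun _ _ => trivial }

theorem mem_top (x : E) : x ∈ (⊤ : VectorSublattice E) := trivial

/-- The inclusion of a vector sublattice. -/
def incl (L : VectorSublattice E) : VLHom L E where
  toLin := L.toSubmodule.subtype
  isLatticeHom _ _ := ⟨rfl, rfl⟩

open Classical in
/-- The extension of a function on `L` by zero, which lets homomorphisms defined on different
sublattices be compared as functions on the ambient space. -/
noncomputable def extendZero [Zero R] (L : VectorSublattice E) (f : L → R) (x : E) : R :=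
  if h : x ∈ L then f ⟨x, h⟩ else 0

theorem extendZero_apply [Zero R] (L : VectorSublattice E) (f : L → R) {x : E} (h : x ∈ L) :
    L.extendZero f x = f ⟨x, h⟩ :=
  dif_pos h

end VectorSublattice

namespace VLHom

variable {E F G : Type*} [AddCommGroup E] [Lattice E] [Module ℝ E]
  [AddCommGroup F] [Lattice F] [Module ℝ F] [AddCommGroup G] [Lattice G] [Module ℝ G]

instance : LinearMapClass (VLHom E F) ℝ E F where
  map_add T := T.toLin.map_add
  map_smulₛₗ T := T.toLin.map_smul

instance : LatticeHomClass (VLHom E F) E F where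
  map_sup T x y := (T.isLatticeHom x y).1
  map_inf T x y := (T.isLatticeHom x y).2

theorem map_abs (T : VLHom E F) (x : E) : T |x| = |T x| := by
  rw [abs, abs, SupHomClass.map_sup, map_neg]

theorem le_of_map_le {T : VLHom E F} (hT : Function.Injective T) {x y : E} (h : T x ≤ T y) :
    x ≤ y := by
  rw [← sup_eq_right] at h ⊢
  exact hT (by rw [SupHomClass.map_sup, h])

/-- The composition of vector lattice homomorphisms. -/
def comp (S : VLHom F G) (T : VLHom E F) : VLHom E G where
  toLin := S.toLin.comp T.toLin
  isLatticeHom x y :=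
    ⟨(congrArg S (SupHomClass.map_sup T x y)).trans (SupHomClass.map_sup S _ _),
      (congrArg S (InfHomClass.map_inf T x y)).trans (InfHomClass.map_inf S _ _)⟩

theorem comp_apply (S : VLHom F G) (T : VLHom E F) (x : E) : S.comp T x = S (T x) := rfl

end VLHom

/-- `ψ` restricts to a vector lattice homomorphism on `L`; its values outside `L` are
irrelevant. -/
structure IsLatticeHomOn {E R : Type*} [AddCommGroup E] [Lattice E] [Module ℝ E]
    [AddCommGroup R] [Lattice R] [Module ℝ R] (ψ : E → R) (L : VectorSublattice E) : Prop where
  map_add : ∀ x ∈ L, ∀ y ∈ L, ψ (x + y) = ψ x + ψ y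
  map_smul : ∀ (r : ℝ), ∀ x ∈ L, ψ (r • x) = r • ψ x
  map_sup : ∀ x ∈ L, ∀ y ∈ L, ψ (x ⊔ y) = ψ x ⊔ ψ y
  map_inf : ∀ x ∈ L, ∀ y ∈ L, ψ (x ⊓ y) = ψ x ⊓ ψ y

theorem VLHom.isLatticeHomOn {E R : Type*} [AddCommGroup E] [Lattice E] [Module ℝ E]
    [AddCommGroup R] [Lattice R] [Module ℝ R] (T : VLHom E R) (L : VectorSublattice E) :
    IsLatticeHomOn T L where
  map_add x _ y _ := map_add T x y
  map_smul r x _ := map_smul T r x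
  map_sup x _ y _ := SupHomClass.map_sup T x y
  map_inf x _ y _ := InfHomClass.map_inf T x y

namespace IsLatticeHomOn

variable {E R S : Type*} [AddCommGroup E] [Lattice E] [Module ℝ E]
  [AddCommGroup R] [Lattice R] [Module ℝ R] [AddCommGroup S] [Lattice S] [Module ℝ S]
  {ψ ψ' : E → R} {L M : VectorSublattice E}

theorem map_zero (h : IsLatticeHomOn ψ L) : ψ 0 = 0 := by
  simpa only [zero_smul] using h.map_smul 0 0 (zero_mem L)

theorem map_neg (h : IsLatticeHomOn ψ L) {x : E} (hx : x ∈ L) : ψ (-x) = -ψ x := by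
  simpa only [neg_smul, one_smul] using h.map_smul (-1) x hx

theorem map_sub (h : IsLatticeHomOn ψ L) {x y : E} (hx : x ∈ L) (hy : y ∈ L) :
    ψ (x - y) = ψ x - ψ y := by
  rw [sub_eq_add_neg, h.map_add x hx _ (neg_mem hy), h.map_neg hy, sub_eq_add_neg]

theorem map_abs (h : IsLatticeHomOn ψ L) {x : E} (hx : x ∈ L) : ψ |x| = |ψ x| := by
  rw [abs, abs, h.map_sup x hx _ (neg_mem hx), h.map_neg hx]

theorem map_le (h : IsLatticeHomOn ψ L) {x y : E} (hx : x ∈ L) (hy : y ∈ L) (hxy : x ≤ y) :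
    ψ x ≤ ψ y := by
  rw [← sup_eq_right.2 hxy, h.map_sup x hx y hy]
  exact le_sup_left

theorem map_sum (h : IsLatticeHomOn ψ L) {ι : Type*} (s : Finset ι) {f : ι → E}
    (hf : ∀ i, f i ∈ L) : ψ (∑ i ∈ s, f i) = ∑ i ∈ s, ψ (f i) := by
  classical
  induction s using Finset.induction_on with
  | empty => simpa only [Finset.sum_empty] using h.map_zero
  | insert a s ha ih =>
    rw [Finset.sum_insert ha, Finset.sum_insert ha,
      h.map_add _ (hf a) _ (sum_mem fun i _ => hf i), ih]

theorem mono (h : IsLatticeHomOn ψ L) (hM : (M : Set E) ⊆ L) : IsLatticeHomOn ψ M where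
  map_add x hx y hy := h.map_add x (hM hx) y (hM hy)
  map_smul r x hx := h.map_smul r x (hM hx)
  map_sup x hx y hy := h.map_sup x (hM hx) y (hM hy)
  map_inf x hx y hy := h.map_inf x (hM hx) y (hM hy)

theorem comp {χ : R → S} {N : VectorSublattice R} (hχ : IsLatticeHomOn χ N)
    (h : IsLatticeHomOn ψ L) (hN : ∀ x ∈ L, ψ x ∈ N) : IsLatticeHomOn (χ ∘ ψ) L where
  map_add x hx y hy := by
    rw [Function.comp, h.map_add x hx y hy, hχ.map_add _ (hN x hx) _ (hN y hy)]; rfl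
  map_smul r x hx := by rw [Function.comp, h.map_smul r x hx, hχ.map_smul r _ (hN x hx)]; rfl
  map_sup x hx y hy := by
    rw [Function.comp, h.map_sup x hx y hy, hχ.map_sup _ (hN x hx) _ (hN y hy)]; rfl
  map_inf x hx y hy := by
    rw [Function.comp, h.map_inf x hx y hy, hχ.map_inf _ (hN x hx) _ (hN y hy)]; rfl

theorem extendZero (T : VLHom L R) : IsLatticeHomOn (L.extendZero T) L where
  map_add x hx y hy := by
    rw [L.extendZero_apply T hx, L.extendZero_apply T hy, L.extendZero_apply T (add_mem hx hy)]
    exact _root_.map_add T ⟨x, hx⟩ ⟨y, hy⟩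
  map_smul r x hx := by
    rw [L.extendZero_apply T hx, L.extendZero_apply T (SMulMemClass.smul_mem r hx)]
    exact _root_.map_smul T r ⟨x, hx⟩
  map_sup x hx y hy := by
    rw [L.extendZero_apply T hx, L.extendZero_apply T hy, L.extendZero_apply T (L.sup_mem hx hy)]
    exact SupHomClass.map_sup T (⟨x, hx⟩ : L) (⟨y, hy⟩ : L)
  map_inf x hx y hy := by
    rw [L.extendZero_apply T hx, L.extendZero_apply T hy, L.extendZero_apply T (L.inf_mem hx hy)]
    exact InfHomClass.map_inf T (⟨x, hx⟩ : L) (⟨y, hy⟩ : L)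

/-- The homomorphism on `L` to which `ψ` restricts. -/
def toVLHom (h : IsLatticeHomOn ψ L) : VLHom L R where
  toLin :=
    { toFun := fun x => ψ x
      map_add' := fun x y => h.map_add x x.2 y y.2
      map_smul' := fun r x => h.map_smul r x x.2 }
  isLatticeHom x y := ⟨h.map_sup x x.2 y y.2, h.map_inf x x.2 y y.2⟩

/-- The part of `L` that is mapped into `N`. -/
def preimage (h : IsLatticeHomOn ψ L) (N : VectorSublattice R) : VectorSublattice E where
  carrier := {x | x ∈ L ∧ ψ x ∈ N}
  add_mem' hx hy :=
    ⟨add_mem hx.1 hy.1, by rw [h.map_add _ hx.1 _ hy.1]; exact add_mem hx.2 hy.2⟩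
  zero_mem' := ⟨zero_mem L, by rw [h.map_zero]; exact zero_mem N⟩
  smul_mem' r _ hx :=
    ⟨SMulMemClass.smul_mem r hx.1, by
      rw [h.map_smul r _ hx.1]; exact SMulMemClass.smul_mem r hx.2⟩
  sup_mem' hx hy :=
    ⟨L.sup_mem hx.1 hy.1, by rw [h.map_sup _ hx.1 _ hy.1]; exact N.sup_mem hx.2 hy.2⟩
  inf_mem' hx hy :=
    ⟨L.inf_mem hx.1 hy.1, by rw [h.map_inf _ hx.1 _ hy.1]; exact N.inf_mem hx.2 hy.2⟩

/-- The part of `L` on which `ψ` and `ψ'` agree. -/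
def eqLocus (h : IsLatticeHomOn ψ L) (h' : IsLatticeHomOn ψ' L) : VectorSublattice E where
  carrier := {x | x ∈ L ∧ ψ x = ψ' x}
  add_mem' hx hy := ⟨add_mem hx.1 hy.1, by
    rw [h.map_add _ hx.1 _ hy.1, h'.map_add _ hx.1 _ hy.1, hx.2, hy.2]⟩
  zero_mem' := ⟨zero_mem L, by rw [h.map_zero, h'.map_zero]⟩
  smul_mem' r x hx := ⟨SMulMemClass.smul_mem r hx.1, by
    rw [h.map_smul r _ hx.1, h'.map_smul r _ hx.1, hx.2]⟩
  sup_mem' hx hy := ⟨L.sup_mem hx.1 hy.1, by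
    rw [h.map_sup _ hx.1 _ hy.1, h'.map_sup _ hx.1 _ hy.1, hx.2, hy.2]⟩
  inf_mem' hx hy := ⟨L.inf_mem hx.1 hy.1, by
    rw [h.map_inf _ hx.1 _ hy.1, h'.map_inf _ hx.1 _ hy.1, hx.2, hy.2]⟩

theorem map_mem_generated {A : Set E} (h : IsLatticeHomOn ψ L) (hA : A ⊆ L) {B : Set R}
    (hB : ∀ x ∈ A, ψ x ∈ VectorSublattice.generated B) {x : E}
    (hx : x ∈ VectorSublattice.generated A) : ψ x ∈ VectorSublattice.generated B :=
  (VectorSublattice.generated_subset (L := h.preimage (VectorSublattice.generated B))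
    (fun y hy => ⟨hA hy, hB y hy⟩) hx).2

end IsLatticeHomOn

theorem PosHomFun.map_zero {m : ℕ} (h : PosHomFun m) : h.toFun 0 = 0 := by
  simpa only [zero_smul, zero_mul] using h.map_smul 0 0 le_rfl

theorem HasValue.apply_eq {E : Type*} [AddCommGroup E] [Lattice E] [Module ℝ E] {m : ℕ}
    {h : PosHomFun m} {a : Fin m → E} {b : E} (hv : HasValue h a b) {ω : E → ℝ}
    {L : VectorSublattice E} (hω : IsLatticeHomOn ω L) (ha : ∀ i, a i ∈ L) (hb : b ∈ L) :
    ω b = h.toFun fun i => ω (a i) := by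
  have hL : insert b (Set.range a) ⊆ (L : Set E) :=
    Set.insert_subset hb (Set.range_subset_iff.2 ha)
  by_cases hne : ∃ x, (hω.mono (VectorSublattice.generated_subset hL)).toVLHom x ≠ 0
  · exact (hv _ hne).symm
  · push Not at hne
    have hb0 : ω b = 0 := hne ⟨b, VectorSublattice.subset_generated _ (Or.inl rfl)⟩
    have ha0 : (fun i => ω (a i)) = 0 := funext fun i =>
      hne ⟨a i, VectorSublattice.subset_generated _ (Or.inr ⟨i, rfl⟩)⟩
    rw [ha0, hb0, h.map_zero]

/-! ### Real-valued homomorphisms on countably generated sublattices -/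

section PrimeIdeal

variable {E : Type*} [AddCommGroup E] [Lattice E] [Module ℝ E]

/-- `P` is the positive cone of an order ideal of `E`; order ideals are only ever used through
their positive cones. -/
structure IsPosIdeal (P : Set E) : Prop where
  nonneg : ∀ x ∈ P, 0 ≤ x
  zero_mem : (0 : E) ∈ P
  add_mem : ∀ x ∈ P, ∀ y ∈ P, x + y ∈ P
  smul_mem : ∀ r : ℝ, 0 ≤ r → ∀ x ∈ P, r • x ∈ P
  mem_of_le : ∀ x y, 0 ≤ x → x ≤ y → y ∈ P → x ∈ P

/-- Primality of the order ideal with positive cone `P`: the quotient is totally ordered. -/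
def IsPrimeCone (P : Set E) : Prop :=
  ∀ x y : E, 0 ≤ x → 0 ≤ y → x ⊓ y = 0 → x ∈ P ∨ y ∈ P

/-- The positive cone of the order ideal generated by `P` and `x`. -/
def adjoinCone (P : Set E) (x : E) : Set E :=
  {z | 0 ≤ z ∧ ∃ i ∈ P, ∃ r : ℝ, 0 ≤ r ∧ z ≤ i + r • x}

namespace IsPosIdeal

variable {P : Set E}

theorem singleton_zero : IsPosIdeal ({0} : Set E) where
  nonneg := by rintro _ rfl; exact le_rfl
  zero_mem := rfl
  add_mem := by rintro _ rfl _ rfl; exact add_zero 0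
  smul_mem := by rintro r - _ rfl; exact smul_zero r
  mem_of_le := by rintro x _ hx hxy rfl; exact le_antisymm hxy hx

theorem sUnion {c : Set (Set E)} (hc : ∀ s ∈ c, IsPosIdeal s) (hchain : IsChain (· ⊆ ·) c)
    (hne : c.Nonempty) : IsPosIdeal (⋃₀ c) where
  nonneg := by rintro x ⟨s, hs, hx⟩; exact (hc s hs).nonneg x hx
  zero_mem := hne.imp fun s hs => ⟨hs, (hc s hs).zero_mem⟩
  add_mem := by
    rintro x ⟨s, hs, hx⟩ y ⟨t, ht, hy⟩
    rcases hchain.total hs ht with hst | hts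
    · exact ⟨t, ht, (hc t ht).add_mem x (hst hx) y hy⟩
    · exact ⟨s, hs, (hc s hs).add_mem x hx y (hts hy)⟩
  smul_mem := by rintro r hr x ⟨s, hs, hx⟩; exact ⟨s, hs, (hc s hs).smul_mem r hr x hx⟩
  mem_of_le := by
    rintro x y hx hxy ⟨s, hs, hy⟩; exact ⟨s, hs, (hc s hs).mem_of_le x y hx hxy hy⟩

theorem subset_adjoinCone (hP : IsPosIdeal P) (x : E) : P ⊆ adjoinCone P x := fun z hz =>
  ⟨hP.nonneg z hz, z, hz, 0, le_rfl, by rw [zero_smul, add_zero]⟩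

theorem mem_adjoinCone (hP : IsPosIdeal P) {x : E} (hx : 0 ≤ x) : x ∈ adjoinCone P x :=
  ⟨hx, 0, hP.zero_mem, 1, zero_le_one, by rw [one_smul, zero_add]⟩

variable [IsOrderedAddMonoid E] [PosSMulMono ℝ E]

theorem adjoinCone (hP : IsPosIdeal P) (x : E) : IsPosIdeal (adjoinCone P x) where
  nonneg z hz := hz.1
  zero_mem := hP.subset_adjoinCone x hP.zero_mem
  add_mem := by
    rintro y ⟨hy, i, hi, r, hr, hyi⟩ z ⟨hz, j, hj, t, ht, hzj⟩
    refine ⟨add_nonneg hy hz, i + j, hP.add_mem i hi j hj, r + t, add_nonneg hr ht, ?_⟩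
    calc y + z ≤ (i + r • x) + (j + t • x) := add_le_add hyi hzj
      _ = (i + j) + (r + t) • x := by module
  smul_mem := by
    rintro c hc y ⟨hy, i, hi, r, hr, hyi⟩
    refine ⟨smul_nonneg hc hy, c • i, hP.smul_mem c hc i hi, c * r, mul_nonneg hc hr, ?_⟩
    rw [mul_smul, ← smul_add]
    exact smul_le_smul_of_nonneg_left hyi hc
  mem_of_le := by
    rintro y z hy hyz ⟨-, i, hi, r, hr, hzi⟩
    exact ⟨hy, i, hi, r, hr, hyz.trans hzi⟩

theorem isPrimeCone_of_maximal {u : ℕ → E} (hu : Antitone u) (hpos : ∀ n, 0 < u n)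
    (hP : Maximal (fun Q : Set E => IsPosIdeal Q ∧ ∀ n, u n ∉ Q) P) : IsPrimeCone P := by
  have hPid : IsPosIdeal P := hP.prop.1
  have exists_mem_adjoin : ∀ x, 0 ≤ x → x ∉ P → ∃ n, u n ∈ _root_.adjoinCone P x := by
    intro x hx hxP
    by_contra! hnot
    exact hxP (hP.le_of_ge ⟨hPid.adjoinCone x, hnot⟩ (hPid.subset_adjoinCone x)
      (hPid.mem_adjoinCone hx))
  intro x y hx hy hxy
  by_contra! hmem
  obtain ⟨n, -, i, hi, r, hr, hn⟩ := exists_mem_adjoin x hx hmem.1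
  obtain ⟨m, -, j, hj, t, ht, hm⟩ := exists_mem_adjoin y hy hmem.2
  have hx' : u (max n m) ≤ (i + j) + r • x := (hu (le_max_left n m)).trans
    (hn.trans (add_le_add_left (le_add_of_nonneg_right (hPid.nonneg j hj)) _))
  have hy' : u (max n m) ≤ (i + j) + t • y := (hu (le_max_right n m)).trans
    (hm.trans (add_le_add_left (le_add_of_nonneg_left (hPid.nonneg i hi)) _))
  have hij : u (max n m) ≤ i + j := by
    simpa only [← add_inf, smul_inf_smul_eq_zero hx hy hxy hr ht, add_zero] using le_inf hx' hy'
  exact hP.prop.2 _ (hPid.mem_of_le _ _ (hpos _).le hij (hPid.add_mem i hi j hj))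

end IsPosIdeal

theorem exists_isPosIdeal_isPrimeCone [IsOrderedAddMonoid E] [PosSMulMono ℝ E] {u : ℕ → E}
    (hu : Antitone u) (hpos : ∀ n, 0 < u n) :
    ∃ P : Set E, IsPosIdeal P ∧ IsPrimeCone P ∧ ∀ n, u n ∉ P := by
  obtain ⟨P, -, hP⟩ := zorn_subset_nonempty {Q : Set E | IsPosIdeal Q ∧ ∀ n, u n ∉ Q}
    (fun c hc hchain hne => ⟨⋃₀ c,
      ⟨IsPosIdeal.sUnion (fun s hs => (hc hs).1) hchain hne,
        fun n ⟨s, hs, hn⟩ => (hc hs).2 n hn⟩,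
      fun s hs => Set.subset_sUnion_of_mem hs⟩)
    {0} ⟨IsPosIdeal.singleton_zero, fun n hn => (hpos n).ne' hn⟩
  exact ⟨P, hP.prop.1, IsPosIdeal.isPrimeCone_of_maximal hu hpos hP, hP.prop.2⟩

/-- `x ≤ 0` in the quotient by the order ideal with positive cone `P`. -/
def NonposMod (P : Set E) (x : E) : Prop := x ⊔ 0 ∈ P

namespace NonposMod

variable {P : Set E}

theorem of_nonpos (hP : IsPosIdeal P) {x : E} (hx : x ≤ 0) : NonposMod P x := by
  rw [NonposMod, sup_eq_right.2 hx]
  exact hP.zero_mem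

theorem mono (hP : IsPosIdeal P) {x y : E} (hxy : x ≤ y) (hy : NonposMod P y) : NonposMod P x :=
  hP.mem_of_le _ _ le_sup_right (sup_le_sup_right hxy 0) hy

theorem smul [PosSMulMono ℝ E] (hP : IsPosIdeal P) {r : ℝ} (hr : 0 ≤ r) {x : E}
    (hx : NonposMod P x) : NonposMod P (r • x) := by
  simpa only [NonposMod, smul_sup_of_nonneg hr, smul_zero] using hP.smul_mem r hr _ hx

theorem not_smul [PosSMulMono ℝ E] (hP : IsPosIdeal P) {e : E} (he : 0 ≤ e) (heP : e ∉ P) {t : ℝ}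
    (ht : 0 < t) : ¬ NonposMod P (t • e) := fun hn => heP <| by
  simpa only [inv_smul_smul₀ ht.ne', NonposMod, sup_eq_left.2 he]
    using hn.smul hP (inv_nonneg.2 ht.le)

variable [IsOrderedAddMonoid E]

omit [Module ℝ E] in
theorem total (hprime : IsPrimeCone P) (x : E) : NonposMod P x ∨ NonposMod P (-x) := by
  refine hprime _ _ le_sup_right le_sup_right ?_
  simpa only [posPart_def, negPart_def] using posPart_inf_negPart_eq_zero x

theorem add (hP : IsPosIdeal P) {x y : E} (hx : NonposMod P x) (hy : NonposMod P y) :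
    NonposMod P (x + y) :=
  hP.mem_of_le _ _ le_sup_right (sup_le (add_le_add le_sup_left le_sup_left)
    (add_nonneg le_sup_right le_sup_right)) (hP.add_mem _ hx _ hy)

theorem sup (hP : IsPosIdeal P) {x y : E} (hx : NonposMod P x) (hy : NonposMod P y) :
    NonposMod P (x ⊔ y) := by
  refine hP.mem_of_le _ _ le_sup_right (sup_le (sup_le ?_ ?_) ?_) (hP.add_mem _ hx _ hy)
  · exact le_add_of_le_of_nonneg le_sup_left le_sup_right
  · exact le_add_of_nonneg_of_le le_sup_right le_sup_left
  · exact add_nonneg le_sup_right le_sup_right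

end NonposMod

/-- In the quotient by the order ideal with positive cone `P`, the element `x` differs from
`c • e` by an infinitesimal relative to `e`. -/
def IsValueMod (P : Set E) (e x : E) (c : ℝ) : Prop :=
  ∀ ε : ℝ, 0 < ε → NonposMod P (x - (c + ε) • e) ∧ NonposMod P ((c - ε) • e - x)

namespace IsValueMod

variable {P : Set E} {e x y : E} {c d : ℝ}

theorem neg (hx : IsValueMod P e x c) : IsValueMod P e (-x) (-c) := by
  intro ε hε
  constructor
  · convert (hx ε hε).2 using 1
    module
  · convert (hx ε hε).1 using 1
    module

variable [IsOrderedAddMonoid E]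

theorem add (hP : IsPosIdeal P) (hx : IsValueMod P e x c) (hy : IsValueMod P e y d) :
    IsValueMod P e (x + y) (c + d) := by
  intro ε hε
  constructor
  · convert (hx _ (half_pos hε)).1.add hP (hy _ (half_pos hε)).1 using 1
    module
  · convert (hx _ (half_pos hε)).2.add hP (hy _ (half_pos hε)).2 using 1
    module

variable [PosSMulMono ℝ E]

theorem le_of_le (hP : IsPosIdeal P) (he : 0 ≤ e) (heP : e ∉ P) (hx : IsValueMod P e x c)
    (hy : IsValueMod P e y d) (hxy : x ≤ y) : c ≤ d := by
  by_contra! hlt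
  have hε : 0 < (c - d) / 3 := by linarith
  refine NonposMod.not_smul hP he heP hε
    (NonposMod.mono hP ?_ ((hx _ hε).2.add hP (hy _ hε).1))
  calc ((c - d) / 3) • e ≤ ((c - d) / 3) • e + (y - x) :=
        le_add_of_nonneg_right (sub_nonneg.2 hxy)
    _ = (c - (c - d) / 3) • e - x + (y - (d + (c - d) / 3) • e) := by module

theorem unique (hP : IsPosIdeal P) (he : 0 ≤ e) (heP : e ∉ P) (hc : IsValueMod P e x c)
    (hd : IsValueMod P e x d) : c = d :=
  le_antisymm (hc.le_of_le hP he heP hd le_rfl) (hd.le_of_le hP he heP hc le_rfl)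

theorem smul_self (hP : IsPosIdeal P) (he : 0 ≤ e) (c : ℝ) : IsValueMod P e (c • e) c := by
  intro ε hε
  have hεe : -(ε • e) ≤ 0 := neg_nonpos.2 (smul_nonneg hε.le he)
  constructor <;> refine NonposMod.of_nonpos hP (le_of_eq_of_le ?_ hεe) <;> module

theorem smul (hP : IsPosIdeal P) (he : 0 ≤ e) (r : ℝ) (hx : IsValueMod P e x c) :
    IsValueMod P e (r • x) (r * c) := by
  have smul_of_pos : ∀ t : ℝ, 0 < t → IsValueMod P e (t • x) (t * c) := by
    intro t ht ε hε
    obtain ⟨hle, hge⟩ := hx (ε / t) (div_pos hε ht)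
    have hε' : ε = t * (ε / t) := (mul_div_cancel₀ ε ht.ne').symm
    rw [hε', ← mul_add, ← mul_sub, mul_smul, mul_smul, ← smul_sub, ← smul_sub]
    exact ⟨hle.smul hP ht.le, hge.smul hP ht.le⟩
  rcases lt_trichotomy r 0 with hr | rfl | hr
  · simpa only [neg_smul, neg_mul, neg_neg] using (smul_of_pos (-r) (neg_pos.2 hr)).neg
  · simpa only [zero_smul, zero_mul] using smul_self hP he 0
  · exact smul_of_pos r hr

theorem sup (hP : IsPosIdeal P) (he : 0 ≤ e) (hx : IsValueMod P e x c)
    (hy : IsValueMod P e y d) : IsValueMod P e (x ⊔ y) (c ⊔ d) := by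
  intro ε hε
  constructor
  · rw [sup_sub]
    have le_of_le : ∀ z b, b ≤ c ⊔ d → z - (c ⊔ d + ε) • e ≤ z - (b + ε) • e := fun z b hb =>
      sub_le_sub_left (smul_le_smul_of_nonneg_right (add_le_add_left hb ε) he) z
    exact (NonposMod.mono hP (le_of_le x c le_sup_left) (hx ε hε).1).sup hP
      (NonposMod.mono hP (le_of_le y d le_sup_right) (hy ε hε).1)
  · rcases le_total c d with h | h
    · rw [sup_eq_right.2 h]
      exact NonposMod.mono hP (sub_le_sub_left le_sup_right _) (hy ε hε).2
    · rw [sup_eq_left.2 h]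
      exact NonposMod.mono hP (sub_le_sub_left le_sup_left _) (hx ε hε).2

theorem inf (hP : IsPosIdeal P) (he : 0 ≤ e) (hx : IsValueMod P e x c)
    (hy : IsValueMod P e y d) : IsValueMod P e (x ⊓ y) (c ⊓ d) := by
  simpa only [← neg_inf, neg_neg] using (hx.neg.sup hP he hy.neg).neg

theorem exists_of_bounded (hP : IsPosIdeal P) (hprime : IsPrimeCone P) (he : 0 ≤ e) (heP : e ∉ P)
    {K : ℝ} (h : NonposMod P (|x| - K • e)) : ∃ c, IsValueMod P e x c := by
  set S : Set ℝ := {r | NonposMod P (r • e - x)}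
  have neg_mem : -K ∈ S := by
    refine NonposMod.mono hP ?_ h
    calc -K • e - x = -x - K • e := by module
      _ ≤ |x| - K • e := sub_le_sub_right (neg_le_abs x) _
  have bddAbove : BddAbove S := by
    refine ⟨K, fun r hr => ?_⟩
    by_contra! hlt
    refine NonposMod.not_smul hP he heP (sub_pos.2 hlt) (NonposMod.mono hP ?_ (hr.add hP h))
    calc (r - K) • e = r • e - x + (x - K • e) := by module
      _ ≤ r • e - x + (|x| - K • e) := by gcongr; exact le_abs_self x
  refine ⟨sSup S, fun ε hε => ⟨?_, ?_⟩⟩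
  · have notMem : sSup S + ε ∉ S := fun hmem =>
      (lt_add_of_pos_right _ hε).not_ge (le_csSup bddAbove hmem)
    simpa only [neg_sub] using
      (NonposMod.total hprime ((sSup S + ε) • e - x)).resolve_left notMem
  · obtain ⟨r, hr, hlt⟩ := exists_lt_of_lt_csSup ⟨_, neg_mem⟩ (sub_lt_self (sSup S) hε)
    exact NonposMod.mono hP
      (sub_le_sub_right (smul_le_smul_of_nonneg_right hlt.le he) x) hr

end IsValueMod

variable [IsOrderedAddMonoid E] [PosSMulMono ℝ E]

/-- The elements that have a value relative to the unit `e` in the quotient by `P`. -/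
def IsPosIdeal.valueSublattice {P : Set E} (hP : IsPosIdeal P) {e : E} (he : 0 ≤ e) :
    VectorSublattice E where
  carrier := {x | ∃ c, IsValueMod P e x c}
  add_mem' := fun ⟨c, hc⟩ ⟨d, hd⟩ => ⟨c + d, hc.add hP hd⟩
  zero_mem' := ⟨0, by simpa only [zero_smul] using IsValueMod.smul_self hP he 0⟩
  smul_mem' := fun r _ ⟨c, hc⟩ => ⟨r * c, hc.smul hP he r⟩
  sup_mem' := fun ⟨c, hc⟩ ⟨d, hd⟩ => ⟨c ⊔ d, hc.sup hP he hd⟩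
  inf_mem' := fun ⟨c, hc⟩ ⟨d, hd⟩ => ⟨c ⊓ d, hc.inf hP he hd⟩

theorem IsPosIdeal.exists_isLatticeHomOn_valueSublattice {P : Set E} (hP : IsPosIdeal P) {e : E}
    (he : 0 ≤ e) (heP : e ∉ P) :
    ∃ ω : E → ℝ, IsLatticeHomOn ω (hP.valueSublattice he) ∧ ω e = 1 := by
  classical
  let ω : E → ℝ := fun x => if h : ∃ c, IsValueMod P e x c then h.choose else 0
  have hω : ∀ {x c}, IsValueMod P e x c → ω x = c := fun {x c} hc => by
    have h : ∃ c, IsValueMod P e x c := ⟨c, hc⟩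
    exact (dif_pos h).trans (h.choose_spec.unique hP he heP hc)
  have isValueMod_self : IsValueMod P e e 1 := by
    simpa only [one_smul] using IsValueMod.smul_self hP he 1
  refine ⟨ω, ⟨?_, ?_, ?_, ?_⟩, hω isValueMod_self⟩
  · rintro x ⟨c, hc⟩ y ⟨d, hd⟩
    rw [hω hc, hω hd, hω (hc.add hP hd)]
  · rintro r x ⟨c, hc⟩
    rw [hω hc, hω (hc.smul hP he r), smul_eq_mul]
  · rintro x ⟨c, hc⟩ y ⟨d, hd⟩
    rw [hω hc, hω hd, hω (hc.sup hP he hd)]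
  · rintro x ⟨c, hc⟩ y ⟨d, hd⟩
    rw [hω hc, hω hd, hω (hc.inf hP he hd)]

end PrimeIdeal

section RealHom

variable {E : Type*} [AddCommGroup E] [Lattice E] [Module ℝ E] [ArchimedeanVectorLattice E]

theorem exists_pos_sub_smul_abs_sup_pos {e : E} (he : 0 < e) (c : E) :
    ∃ k : ℝ, 0 < k ∧ 0 < (e - k • |c|) ⊔ 0 := by
  by_contra! hnot
  refine he.ne' (ArchimedeanVectorLattice.eq_zero_of_forall_le_smul (p := |c|) he.le
    fun ε hε => ?_)
  have : (e - ε • |c|) ⊔ 0 = 0 :=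
    (eq_of_le_of_not_lt le_sup_right (hnot ε hε)).symm
  exact sub_nonpos.1 (sup_eq_right.1 this)

/-- Modulo a prime ideal containing no `u n`, each `|c n|` is at most a multiple of `u n ≤ e`. -/
theorem exists_antitone_pos_sub_smul_abs {e : E} (he : 0 < e) (c : ℕ → E) :
    ∃ u : ℕ → E, u 0 = e ∧ Antitone u ∧ (∀ n, 0 < u n) ∧
      ∀ n, ∃ k : ℝ, 0 < k ∧ u (n + 1) = (u n - k • |c n|) ⊔ 0 := by
  choose k hk hpos using fun (x : {x : E // 0 < x}) (d : E) =>
    exists_pos_sub_smul_abs_sup_pos x.2 d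
  let u : ℕ → {x : E // 0 < x} :=
    fun n => Nat.rec ⟨e, he⟩ (fun n x => ⟨(x.1 - k x (c n) • |c n|) ⊔ 0, hpos x (c n)⟩) n
  refine ⟨fun n => (u n).1, rfl, antitone_nat_of_succ_le fun n => ?_, fun n => (u n).2, fun n =>
    ⟨k (u n) (c n), hk (u n) (c n), rfl⟩⟩
  exact sup_le (sub_le_self _ (smul_nonneg (hk _ _).le (abs_nonneg _))) (u n).2.le

theorem exists_isLatticeHomOn_generated_eq_one {C : Set E} (hC : C.Countable) {e : E}
    (heC : e ∈ C) (he : 0 < e) :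
    ∃ ω : E → ℝ, IsLatticeHomOn ω (VectorSublattice.generated C) ∧ ω e = 1 := by
  obtain ⟨c, rfl⟩ := hC.exists_eq_range ⟨e, heC⟩
  obtain ⟨u, hu0, hu, hupos, hstep⟩ := exists_antitone_pos_sub_smul_abs he c
  obtain ⟨P, hP, hprime, huP⟩ := exists_isPosIdeal_isPrimeCone hu hupos
  have heP : e ∉ P := hu0 ▸ huP 0
  obtain ⟨ω, hω, hωe⟩ := hP.exists_isLatticeHomOn_valueSublattice he.le heP
  refine ⟨ω, hω.mono (VectorSublattice.generated_subset ?_), hωe⟩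
  rintro _ ⟨n, rfl⟩
  obtain ⟨k, hk, hun⟩ := hstep n
  have not_nonposMod : ¬ NonposMod P (u n - k • |c n|) := by
    rw [NonposMod, ← hun]
    exact huP (n + 1)
  have hle : NonposMod P (k⁻¹ • (k • |c n| - u n)) := by
    rw [← neg_sub]
    exact ((NonposMod.total hprime _).resolve_left not_nonposMod).smul hP (inv_nonneg.2 hk.le)
  refine IsValueMod.exists_of_bounded hP hprime he.le heP (K := k⁻¹) (NonposMod.mono hP ?_ hle)
  rw [smul_sub, inv_smul_smul₀ hk.ne']
  exact sub_le_sub_left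
    (smul_le_smul_of_nonneg_left ((hu n.zero_le).trans hu0.le) (inv_nonneg.2 hk.le)) _

end RealHom

/-! ### Relatively uniform convergence -/

section Regulator

variable {E R : Type*} [AddCommGroup E] [Lattice E] [Module ℝ E]
  [AddCommGroup R] [Lattice R] [Module ℝ R]

/-- Relatively uniform convergence with regulator `p`. The inequality is not strict, so that the
notion is preserved by homomorphisms that annihilate `p`. -/
def RUConvergesWith (p : E) (f : ℕ → E) (g : E) : Prop :=
  ∀ ε : ℝ, 0 < ε → ∃ N : ℕ, ∀ n, N ≤ n → |f n - g| ≤ ε • p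

/-- The relatively uniform Cauchy property with regulator `p`. -/
def RUCauchyWith (p : E) (f : ℕ → E) : Prop :=
  ∀ ε : ℝ, 0 < ε → ∃ N : ℕ, ∀ m n, N ≤ m → N ≤ n → |f m - f n| ≤ ε • p

theorem RUCauchy.exists_ruCauchyWith {f : ℕ → E} (h : RUCauchy f) :
    ∃ p, 0 < p ∧ RUCauchyWith p f := by
  obtain ⟨p, hp, h⟩ := h
  exact ⟨p, hp, fun ε hε => (h ε hε).imp fun N hN m n hm hn => (hN m n hm hn).le⟩

theorem RUConvergesWith.map {ψ : E → R} {L : VectorSublattice E} (hψ : IsLatticeHomOn ψ L) {p : E}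
    {f : ℕ → E} {g : E} (hp : p ∈ L) (hf : ∀ n, f n ∈ L) (hg : g ∈ L)
    (h : RUConvergesWith p f g) : RUConvergesWith (ψ p) (fun n => ψ (f n)) (ψ g) := by
  refine fun ε hε => (h ε hε).imp fun N hN n hn => ?_
  have hfg : f n - g ∈ L := sub_mem (hf n) hg
  rw [← hψ.map_sub (hf n) hg, ← hψ.map_abs hfg, ← hψ.map_smul ε p hp]
  exact hψ.map_le (L.abs_mem hfg) (SMulMemClass.smul_mem ε hp) (hN n hn)

variable [ArchimedeanVectorLattice E]

instance : SMulPosStrictMono ℝ E := SMulPosMono.toSMulPosStrictMono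

theorem RUConvergesWith.ruConverges {p : E} (hp : 0 < p) {f : ℕ → E} {g : E}
    (h : RUConvergesWith p f g) : RUConverges f g :=
  ⟨p, hp, fun ε hε => (h (ε / 2) (half_pos hε)).imp fun _ hN n hn =>
    (hN n hn).trans_lt (smul_lt_smul_of_pos_right (half_lt_self hε) hp)⟩

theorem RUCauchyWith.ruCauchy {p : E} (hp : 0 < p) {f : ℕ → E} (h : RUCauchyWith p f) :
    RUCauchy f :=
  ⟨p, hp, fun ε hε => (h (ε / 2) (half_pos hε)).imp fun _ hN m n hm hn =>
    (hN m n hm hn).trans_lt (smul_lt_smul_of_pos_right (half_lt_self hε) hp)⟩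

theorem RUCauchyWith.nonneg {p : E} {f : ℕ → E} (h : RUCauchyWith p f) : 0 ≤ p := by
  obtain ⟨N, hN⟩ := h 1 one_pos
  simpa only [one_smul] using (abs_nonneg _).trans (hN N N le_rfl le_rfl)

theorem abs_sub_le_of_lattice (x y z : E) : |x - z| ≤ |x - y| + |y - z| := by
  simpa only [sub_add_sub_cancel] using abs_add_le (x - y) (y - z)

theorem RUConvergesWith.ruCauchyWith {p : E} {f : ℕ → E} {g : E} (h : RUConvergesWith p f g) :
    RUCauchyWith p f := by
  refine fun ε hε => (h (ε / 2) (half_pos hε)).imp fun N hN m n hm hn => ?_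
  calc |f m - f n| ≤ |f m - g| + |f n - g| := by
        rw [abs_sub_comm (f n)]
        exact abs_sub_le_of_lattice _ _ _
    _ ≤ (ε / 2) • p + (ε / 2) • p := add_le_add (hN m hm) (hN n hn)
    _ = ε • p := by rw [← add_smul, add_halves]

theorem RUConvergesWith.unique {p q : E} {f : ℕ → E} {g g' : E} (h : RUConvergesWith p f g)
    (h' : RUConvergesWith q f g') : g = g' := by
  rw [← sub_eq_zero, ← abs_eq_zero_iff_of_lattice]
  refine ArchimedeanVectorLattice.eq_zero_of_forall_le_smul (p := p + q) (abs_nonneg _)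
    fun ε hε => ?_
  obtain ⟨N, hN⟩ := h ε hε
  obtain ⟨M, hM⟩ := h' ε hε
  calc |g - g'| ≤ |f (max N M) - g| + |f (max N M) - g'| := by
        rw [abs_sub_comm _ g]
        exact abs_sub_le_of_lattice _ _ _
    _ ≤ ε • p + ε • q := add_le_add (hN _ (le_max_left N M)) (hM _ (le_max_right N M))
    _ = ε • (p + q) := (smul_add ε p q).symm

/-- The given regulator `p` serves the limit found by completeness with another regulator. -/
theorem IsUniformlyComplete.exists_ruConvergesWith (hE : IsUniformlyComplete E) {p : E}
    {f : ℕ → E} (h : RUCauchyWith p f) : ∃ g, RUConvergesWith p f g := by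
  rcases h.nonneg.eq_or_lt with rfl | hp
  · obtain ⟨N, hN⟩ := h 1 one_pos
    exact ⟨f N, fun ε _ => ⟨N, fun n hn => by simpa only [smul_zero] using hN n N hn le_rfl⟩⟩
  · obtain ⟨g, q, -, hg⟩ := hE f (h.ruCauchy hp)
    refine ⟨g, fun ε hε => (h ε hε).imp fun N hN n hn =>
      ArchimedeanVectorLattice.le_of_forall_le_add_smul (p := q) fun δ hδ => ?_⟩
    obtain ⟨M, hM⟩ := hg δ hδ
    calc |f n - g| ≤ |f n - f (max N M)| + |f (max N M) - g| := abs_sub_le_of_lattice _ _ _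
      _ ≤ ε • p + δ • q :=
        add_le_add (hN _ _ hn (le_max_left N M)) (hM _ (le_max_right N M)).le

end Regulator

namespace VectorSublattice

variable {E R : Type*} [AddCommGroup E] [Lattice E] [Module ℝ E]
  [AddCommGroup R] [Lattice R] [Module ℝ R]

/-- `L` contains the limits of its sequences that converge relatively uniformly with a regulator
in `L`. -/
def RUClosed (L : VectorSublattice E) : Prop :=
  ∀ p ∈ L, ∀ (f : ℕ → E) (g : E), (∀ n, f n ∈ L) → RUConvergesWith p f g → g ∈ L

/-- The smallest relatively uniformly closed vector sublattice containing `A`. -/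
def ruClosure (A : Set E) : VectorSublattice E where
  carrier := {x | ∀ L : VectorSublattice E, L.RUClosed → A ⊆ L → x ∈ L}
  add_mem' hx hy L hL hA := add_mem (hx L hL hA) (hy L hL hA)
  zero_mem' L _ _ := zero_mem L
  smul_mem' r _ hx L hL hA := SMulMemClass.smul_mem r (hx L hL hA)
  sup_mem' hx hy L hL hA := L.sup_mem (hx L hL hA) (hy L hL hA)
  inf_mem' hx hy L hL hA := L.inf_mem (hx L hL hA) (hy L hL hA)

theorem subset_ruClosure (A : Set E) : A ⊆ ruClosure A :=
  fun _ hx _ _ hA => hA hx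

theorem ruClosed_ruClosure (A : Set E) : (ruClosure A).RUClosed :=
  fun p hp f g hf h L hL hA => hL p (hp L hL hA) f g (fun n => hf n L hL hA) h

theorem RUClosed.preimage {ψ : E → R} {L : VectorSublattice E} (hψ : IsLatticeHomOn ψ L)
    (hL : L.RUClosed) {M : VectorSublattice R} (hM : M.RUClosed) : (hψ.preimage M).RUClosed := by
  intro p hp f g hf h
  have hg : g ∈ L := hL p hp.1 f g (fun n => (hf n).1) h
  exact ⟨hg, hM _ hp.2 _ _ (fun n => (hf n).2) (h.map hψ hp.1 (fun n => (hf n).1) hg)⟩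

theorem RUClosed.eqLocus [ArchimedeanVectorLattice R] {ψ ψ' : E → R} {L : VectorSublattice E}
    (hψ : IsLatticeHomOn ψ L) (hψ' : IsLatticeHomOn ψ' L) (hL : L.RUClosed) :
    (hψ.eqLocus hψ').RUClosed := by
  intro p hp f g hf h
  have hfL : ∀ n, f n ∈ L := fun n => (hf n).1
  have hg : g ∈ L := hL p hp.1 f g hfL h
  have hlim : RUConvergesWith (ψ p) (fun n => ψ (f n)) (ψ' g) := by
    simpa only [(hf _).2, hp.2] using h.map hψ' hp.1 hfL hg
  exact ⟨hg, (h.map hψ hp.1 hfL hg).unique hlim⟩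

variable [ArchimedeanVectorLattice E]

theorem RUClosed.isUniformlyComplete {L : VectorSublattice E} (hE : IsUniformlyComplete E)
    (hL : L.RUClosed) : IsUniformlyComplete L := by
  intro f hf
  obtain ⟨p, hp, hf⟩ := hf.exists_ruCauchyWith
  have hf' : RUCauchyWith (p : E) fun n => (f n : E) := hf
  obtain ⟨g, hg⟩ := hE.exists_ruConvergesWith hf'
  refine ⟨⟨g, hL p p.2 _ g (fun n => (f n).2) hg⟩, RUConvergesWith.ruConverges hp ?_⟩
  exact hg

theorem ruClosed_range [ArchimedeanVectorLattice R] (hE : IsUniformlyComplete E) (J : VLHom E R)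
    (hJ : Function.Injective J) : J.range.RUClosed := by
  rintro _ ⟨p, rfl⟩ f g hf h
  choose e he using hf
  obtain rfl : (fun n => J (e n)) = f := funext he
  have cauchy : RUCauchyWith p e := by
    refine fun ε hε => (h.ruCauchyWith ε hε).imp fun N hN m n hm hn => VLHom.le_of_map_le hJ ?_
    rw [J.map_abs, map_sub, map_smul]
    exact hN m n hm hn
  obtain ⟨x, hx⟩ := hE.exists_ruConvergesWith cauchy
  exact ⟨x, (hx.map (J.isLatticeHomOn ⊤) (mem_top p) (fun n => mem_top (e n)) (mem_top x)).unique h⟩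

end VectorSublattice

/-! ### Germs of real functions -/

theorem exists_forall_abs_sub_le_of_ruCauchyWith {p : ℝ} {f : ℕ → ℝ} (h : RUCauchyWith p f) :
    ∃ c, ∀ (ε : ℝ) (N : ℕ), (∀ m n, N ≤ m → N ≤ n → |f m - f n| ≤ ε) →
      ∀ n, N ≤ n → |f n - c| ≤ ε := by
  have hp : 0 ≤ p := by
    obtain ⟨N, hN⟩ := h 1 one_pos
    simpa only [one_smul] using (abs_nonneg _).trans (hN N N le_rfl le_rfl)
  have cauchy : CauchySeq f := by
    rw [Metric.cauchySeq_iff]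
    intro δ hδ
    obtain ⟨N, hN⟩ := h (δ / (p + 1)) (by positivity)
    refine ⟨N, fun m hm n hn => (hN m n hm hn).trans_lt ?_⟩
    rw [smul_eq_mul, div_mul_eq_mul_div, div_lt_iff₀ (by positivity)]
    linarith
  obtain ⟨c, hc⟩ := cauchySeq_tendsto_of_complete cauchy
  exact ⟨c, fun ε N hN n hn => le_of_tendsto (tendsto_const_nhds.sub hc).abs
    ((eventually_ge_atTop N).mono fun m hm => hN n m hn hm)⟩

section Germ

variable {X : Type*} {l : Filter X}

instance : PosSMulMono ℝ (Germ l ℝ) where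
  smul_le_smul_of_nonneg_left _ hr a b := Germ.inductionOn₂ a b fun _ _ hab =>
    (Germ.coe_le.1 hab).mono fun _ hx => mul_le_mul_of_nonneg_left hx hr

variable [CountableInterFilter l]

instance : ArchimedeanVectorLattice (Germ l ℝ) where
  eq_zero_of_nsmul_le a b := Germ.inductionOn₂ a b fun f g hf hfg => by
    have hfg' : ∀ᶠ x in l, ∀ n : ℕ, n • f x ≤ g x :=
      eventually_countable_forall.2 fun n => Germ.coe_le.1 (hfg n)
    refine Germ.coe_eq.2 ?_
    filter_upwards [Germ.coe_nonneg.1 hf, hfg'] with x hfx hx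
    by_contra hne
    obtain ⟨n, hn⟩ := Archimedean.arch (g x + 1) (hfx.lt_of_ne' hne)
    linarith [hx n]

/-- A modulus of convergence is fixed before evaluating at points, so that it is common to almost
all of them. -/
theorem eventually_forall_abs_sub_le {p : X → ℝ} {f : ℕ → X → ℝ}
    (h : RUCauchyWith (p : Germ l ℝ) fun n => (f n : Germ l ℝ)) :
    ∃ N : ℕ → ℕ, ∀ᶠ x in l, ∀ k m n, N k ≤ m → N k ≤ n →
      |f m x - f n x| ≤ (1 / (k + 1 : ℝ)) * p x := by
  choose N hN using fun k : ℕ => h (1 / (k + 1 : ℝ)) Nat.one_div_pos_of_nat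
  refine ⟨N, ?_⟩
  simp only [eventually_countable_forall]
  exact fun k m n hm hn => Germ.coe_le.1 (hN k m n hm hn)

theorem isUniformlyComplete_germ : IsUniformlyComplete (Germ l ℝ) := by
  intro f hf
  obtain ⟨p, hp, hf⟩ := hf.exists_ruCauchyWith
  induction p using Germ.inductionOn with | _ p =>
  choose F hF using fun n => Quotient.exists_rep (f n)
  obtain rfl : (fun n => (F n : Germ l ℝ)) = f := funext hF
  obtain ⟨N, hN⟩ := eventually_forall_abs_sub_le hf
  have cauchy : ∀ᶠ x in l, RUCauchyWith (p x) fun n => F n x := by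
    filter_upwards [hN, Germ.coe_nonneg.1 hp.le] with x hx hpx ε hε
    obtain ⟨k, hk⟩ := exists_nat_one_div_lt hε
    exact ⟨N k, fun m n hm hn =>
      (hx k m n hm hn).trans (mul_le_mul_of_nonneg_right hk.le hpx)⟩
  choose! g hg using fun x =>
    exists_forall_abs_sub_le_of_ruCauchyWith (p := p x) (f := fun n => F n x)
  refine ⟨(g : Germ l ℝ), RUConvergesWith.ruConverges hp fun ε hε => ?_⟩
  obtain ⟨k, hk⟩ := exists_nat_one_div_lt hε
  refine ⟨N k, fun n hn => Germ.coe_le.2 ?_⟩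
  filter_upwards [hN, cauchy, Germ.coe_nonneg.1 hp.le] with x hx hcx hpx
  exact (hg x hcx _ _ (hx k) n hn).trans (mul_le_mul_of_nonneg_right hk.le hpx)

end Germ

section Eval

variable (E : Type*) [AddCommGroup E] [Lattice E] [Module ℝ E]

/-- The filter on real functions on `E` generated by the sets of all functions that are vector
lattice homomorphisms on the sublattice generated by a given countable set. There may be no nonzero
real homomorphism on all of `E`; along this filter one can argue as if there were enough. -/
def evalFilter : Filter (E → ℝ) where
  sets := {A | ∃ C : Set E, C.Countable ∧
    ∀ ω : E → ℝ, IsLatticeHomOn ω (VectorSublattice.generated C) → ω ∈ A}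
  univ_sets := ⟨∅, Set.countable_empty, fun _ _ => trivial⟩
  sets_of_superset := fun ⟨C, hC, h⟩ hAB => ⟨C, hC, fun ω hω => hAB (h ω hω)⟩
  inter_sets := by
    rintro A B ⟨C, hC, hA⟩ ⟨C', hC', hB⟩
    exact ⟨C ∪ C', hC.union hC', fun ω hω =>
      ⟨hA ω (hω.mono (VectorSublattice.generated_mono Set.subset_union_left)),
        hB ω (hω.mono (VectorSublattice.generated_mono Set.subset_union_right))⟩⟩

variable {E}

theorem mem_evalFilter {A : Set (E → ℝ)} : A ∈ evalFilter E ↔ ∃ C : Set E, C.Countable ∧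
    ∀ ω : E → ℝ, IsLatticeHomOn ω (VectorSublattice.generated C) → ω ∈ A := Iff.rfl

theorem eventually_isLatticeHomOn_generated {C : Set E} (hC : C.Countable) :
    ∀ᶠ ω in evalFilter E, IsLatticeHomOn ω (VectorSublattice.generated C) :=
  ⟨C, hC, fun _ h => h⟩

theorem eventually_isLatticeHomOn_pair (x y : E) : ∀ᶠ ω in evalFilter E,
    ∃ L : VectorSublattice E, x ∈ L ∧ y ∈ L ∧ IsLatticeHomOn ω L := by
  filter_upwards [eventually_isLatticeHomOn_generated (Set.countable_insert.2
    (Set.countable_singleton y) : ({x, y} : Set E).Countable)] with ω hω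
  exact ⟨_, VectorSublattice.subset_generated _ (Or.inl rfl),
    VectorSublattice.subset_generated _ (Or.inr rfl), hω⟩

instance : CountableInterFilter (evalFilter E) where
  countable_sInter_mem S hS h := by
    choose! C hC hmem using fun s hs => mem_evalFilter.1 (h s hs)
    exact ⟨⋃ s ∈ S, C s, hS.biUnion hC, fun ω hω s hs => hmem s hs ω
      (hω.mono (VectorSublattice.generated_mono (Set.subset_biUnion_of_mem (u := C) hs)))⟩

variable (E) in
/-- Evaluation at the elements of `E`, as a homomorphism into germs along `evalFilter E`. -/
def evalGerm : VLHom E (Germ (evalFilter E) ℝ) where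
  toLin :=
    { toFun := fun x => ((fun ω => ω x : (E → ℝ) → ℝ) : Germ (evalFilter E) ℝ)
      map_add' := fun x y => Germ.coe_eq.2 <|
        (eventually_isLatticeHomOn_pair x y).mono fun _ ⟨_, hx, hy, hω⟩ => hω.map_add x hx y hy
      map_smul' := fun r x => Germ.coe_eq.2 <|
        (eventually_isLatticeHomOn_pair x x).mono fun _ ⟨_, hx, _, hω⟩ => hω.map_smul r x hx }
  isLatticeHom x y :=
    ⟨Germ.coe_eq.2 <|
        (eventually_isLatticeHomOn_pair x y).mono fun _ ⟨_, hx, hy, hω⟩ => hω.map_sup x hx y hy,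
      Germ.coe_eq.2 <|
        (eventually_isLatticeHomOn_pair x y).mono fun _ ⟨_, hx, hy, hω⟩ => hω.map_inf x hx y hy⟩

theorem evalGerm_injective [ArchimedeanVectorLattice E] : Function.Injective (evalGerm E) := by
  refine (injective_iff_map_eq_zero (evalGerm E)).2 fun x hx => ?_
  by_contra hne
  have hpos : 0 < |x| := (abs_nonneg x).lt_of_ne' (abs_eq_zero_iff_of_lattice.not.2 hne)
  have habs : evalGerm E |x| = 0 := by rw [(evalGerm E).map_abs, hx, abs_zero]
  obtain ⟨C, hC, hzero⟩ := mem_evalFilter.1 (Germ.coe_eq.1 habs)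
  obtain ⟨ω, hω, hone⟩ :=
    exists_isLatticeHomOn_generated_eq_one (hC.insert |x|) (Set.mem_insert |x| C) hpos
  exact zero_ne_one <|
    (hzero ω (hω.mono (VectorSublattice.generated_mono (Set.subset_insert |x| C)))).symm.trans hone

variable {H : Type*} [AddCommGroup H] [Lattice H] [Module ℝ H]

theorem tendsto_comp_evalFilter (T : VLHom E H) :
    Tendsto (fun ω : H → ℝ => ω ∘ T) (evalFilter H) (evalFilter E) := by
  rintro A ⟨C, hC, h⟩
  exact ⟨T '' C, hC.image T, fun ω hω => h _ <| hω.comp (T.isLatticeHomOn _) fun x hx =>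
    (T.isLatticeHomOn ⊤).map_mem_generated (fun y _ => VectorSublattice.mem_top y)
      (fun y hy => VectorSublattice.subset_generated _ (Set.mem_image_of_mem T hy)) hx⟩

/-- The homomorphism of germs that extends `T`; it is given by composition with `T`. -/
def germMap (T : VLHom E H) : VLHom (Germ (evalFilter E) ℝ) (Germ (evalFilter H) ℝ) where
  toLin :=
    { toFun := fun g => g.compTendsto _ (tendsto_comp_evalFilter T)
      map_add' := fun a b => Germ.inductionOn₂ a b fun _ _ => rfl
      map_smul' := fun _ a => Germ.inductionOn a fun _ => rfl }
  isLatticeHom a b := Germ.inductionOn₂ a b fun _ _ => ⟨rfl, rfl⟩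

theorem germMap_evalGerm (T : VLHom E H) (x : E) :
    germMap T (evalGerm E x) = evalGerm H (T x) := rfl

end Eval

/-! ### Existence of uniform completions -/

namespace VLHom

variable {E F G : Type*} [AddCommGroup E] [Lattice E] [Module ℝ E]
  [AddCommGroup F] [Lattice F] [Module ℝ F] [AddCommGroup G] [Lattice G] [Module ℝ G]

theorem exists_factor {J : VLHom G F} (hJ : Function.Injective J) {T : VLHom E F}
    (h : ∀ x, T x ∈ J.range) : ∃ S : VLHom E G, ∀ x, J (S x) = T x := by
  choose S hS using h
  replace hS : ∀ x, J (S x) = T x := hS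
  refine ⟨⟨⟨⟨S, fun x y => hJ ?_⟩, fun r x => hJ ?_⟩, fun x y => ⟨hJ ?_, hJ ?_⟩⟩, hS⟩
  · rw [map_add, hS, hS, hS, map_add]
  · simp only [RingHom.id_apply, map_smul, hS]
  · exact (hS _).trans (by
      rw [SupHomClass.map_sup, SupHomClass.map_sup]; exact congrArg₂ _ (hS x).symm (hS y).symm)
  · exact (hS _).trans (by
      rw [InfHomClass.map_inf, InfHomClass.map_inf]; exact congrArg₂ _ (hS x).symm (hS y).symm)

theorem ext {S T : VLHom E F} (h : ∀ x, S x = T x) : S = T := by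
  obtain ⟨S, hS⟩ := S
  obtain ⟨T, hT⟩ := T
  obtain rfl : S = T := LinearMap.ext h
  rfl

end VLHom

section UniformCompletion

variable {E H : Type*} [AddCommGroup E] [Lattice E] [Module ℝ E]
  [AddCommGroup H] [Lattice H] [Module ℝ H]

variable (E) in
/-- A model of the uniform completion of `E`: the relatively uniformly closed sublattice of germs
generated by the evaluations at elements of `E`. -/
def uniformCompletion : VectorSublattice (Germ (evalFilter E) ℝ) :=
  VectorSublattice.ruClosure (Set.range (evalGerm E))

theorem evalGerm_mem_uniformCompletion (x : E) : evalGerm E x ∈ uniformCompletion E :=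
  VectorSublattice.subset_ruClosure _ ⟨x, rfl⟩

variable (E) in
/-- The embedding of `E` into the model of its uniform completion. -/
def toUniformCompletion : VLHom E (uniformCompletion E) where
  toLin := (evalGerm E).toLin.codRestrict _ evalGerm_mem_uniformCompletion
  isLatticeHom x y := ⟨Subtype.ext (SupHomClass.map_sup (evalGerm E) x y),
    Subtype.ext (InfHomClass.map_inf (evalGerm E) x y)⟩

variable [ArchimedeanVectorLattice H]

theorem exists_extension_toUniformCompletion (hH : IsUniformlyComplete H) (T : VLHom E H) :
    ∃ S : VLHom (uniformCompletion E) H, ∀ x, S (toUniformCompletion E x) = T x := by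
  have hrange : (evalGerm H).range.RUClosed :=
    VectorSublattice.ruClosed_range hH (evalGerm H) evalGerm_injective
  have hclosed := VectorSublattice.ruClosed_ruClosure (Set.range (evalGerm E))
  have mem_range : ∀ y : uniformCompletion E, germMap T y ∈ (evalGerm H).range := by
    refine fun y => (y.2 _ (hclosed.preimage ((germMap T).isLatticeHomOn _) hrange) ?_).2
    rintro _ ⟨x, rfl⟩
    exact ⟨evalGerm_mem_uniformCompletion x, T x, (germMap_evalGerm T x).symm⟩
  obtain ⟨S, hS⟩ := VLHom.exists_factor evalGerm_injective
    (T := (germMap T).comp (uniformCompletion E).incl) mem_range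
  exact ⟨S, fun x => evalGerm_injective ((hS _).trans (germMap_evalGerm T x))⟩

theorem eq_of_comp_toUniformCompletion_eq {S S' : VLHom (uniformCompletion E) H}
    (h : ∀ x, S (toUniformCompletion E x) = S' (toUniformCompletion E x)) : S = S' := by
  have hclosed := VectorSublattice.ruClosed_ruClosure (Set.range (evalGerm E))
  refine VLHom.ext fun y => ?_
  have mem_eqLocus := y.2 _ (hclosed.eqLocus (IsLatticeHomOn.extendZero S)
    (IsLatticeHomOn.extendZero S')) (by
      rintro _ ⟨x, rfl⟩
      have hx := evalGerm_mem_uniformCompletion x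
      refine ⟨hx, ?_⟩
      rw [VectorSublattice.extendZero_apply _ _ hx, VectorSublattice.extendZero_apply _ _ hx]
      exact h x)
  have := mem_eqLocus.2
  rwa [VectorSublattice.extendZero_apply _ _ y.2, VectorSublattice.extendZero_apply _ _ y.2] at this

end UniformCompletion

theorem isUniformCompletion_toUniformCompletion (E : Type u) [AddCommGroup E] [Lattice E]
    [Module ℝ E] [ArchimedeanVectorLattice E] : IsUniformCompletion (toUniformCompletion E) where
  archimedean := inferInstance
  uniformlyComplete := (VectorSublattice.ruClosed_ruClosure _).isUniformlyComplete
    isUniformlyComplete_germ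
  injective _ _ hxy := evalGerm_injective (congrArg Subtype.val hxy)
  existsUnique_extension H _ _ _ _ hH T := by
    obtain ⟨S, hS⟩ := exists_extension_toUniformCompletion hH T
    exact ⟨S, hS, fun S' hS' => eq_of_comp_toUniformCompletion_eq fun x =>
      (hS' x).trans (hS x).symm⟩

/-! ### Functional calculus in germs -/

theorem exists_abs_sub_le_add_mul_dist_of_isCompact {X : Type*} [PseudoMetricSpace X] {s : Set X}
    (hs : IsCompact s) {f : X → ℝ} (hf : Continuous f) (t : X) {ε : ℝ} (hε : 0 < ε) :
    ∃ M, 0 ≤ M ∧ ∀ w ∈ s, |f w - f t| ≤ ε + M * dist w t := by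
  obtain ⟨δ, hδ, near⟩ := Metric.continuousAt_iff.1 (hf.continuousAt (x := t)) ε hε
  obtain ⟨K, hK⟩ := hs.exists_bound_of_continuousOn (f := fun w => f w - f t) (by fun_prop)
  refine ⟨|K| / δ, by positivity, fun w hw => ?_⟩
  rcases lt_or_ge (dist w t) δ with hlt | hge
  · exact (near hlt).le.trans (le_add_of_nonneg_right (by positivity))
  · calc |f w - f t| ≤ |K| / δ * δ := by
          rw [div_mul_cancel₀ _ hδ.ne']
          exact (hK w hw).trans (le_abs_self K)
      _ ≤ |K| / δ * dist w t := by gcongr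
      _ ≤ ε + |K| / δ * dist w t := le_add_of_nonneg_left hε.le

theorem dist_le_sum_abs_sub {m : ℕ} (w t : Fin m → ℝ) : dist w t ≤ ∑ i, |w i - t i| :=
  (dist_pi_le_iff (Finset.sum_nonneg fun _ _ => abs_nonneg _)).2 fun i =>
    Finset.single_le_sum (f := fun i => |w i - t i|) (fun _ _ => abs_nonneg _) (Finset.mem_univ i)

namespace PosHomFun

variable {m : ℕ} (h : PosHomFun m)

theorem exists_abs_sub_mul_le (t : Fin m → ℝ) {ε : ℝ} (hε : 0 < ε) :
    ∃ M, 0 ≤ M ∧ ∀ (y : Fin m → ℝ) (p : ℝ), (∀ i, |y i| ≤ p) → 0 ≤ p →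
      |h.toFun y - h.toFun t * p| ≤ ε * p + M * ∑ i, |y i - t i * p| := by
  obtain ⟨M, hM, unit_ball⟩ := exists_abs_sub_le_add_mul_dist_of_isCompact
    (isCompact_closedBall (0 : Fin m → ℝ) 1) h.continuous_toFun t hε
  refine ⟨M, hM, fun y p hyp hp => ?_⟩
  rcases hp.eq_or_lt with rfl | hp
  · obtain rfl : y = 0 := funext fun i => abs_nonpos_iff.1 (hyp i)
    simp [h.map_zero]
  obtain ⟨w, rfl⟩ : ∃ w : Fin m → ℝ, y = p • w := ⟨p⁻¹ • y, by rw [smul_inv_smul₀ hp.ne']⟩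
  have hw : w ∈ Metric.closedBall (0 : Fin m → ℝ) 1 := by
    refine mem_closedBall_zero_iff.2 ((pi_norm_le_iff_of_nonneg zero_le_one).2 fun i => ?_)
    have := hyp i
    rw [Pi.smul_apply, smul_eq_mul, abs_mul, abs_of_pos hp] at this
    exact le_of_mul_le_mul_left (by rwa [mul_one]) hp
  have homogeneous_sum : ∑ i, |(p • w) i - t i * p| = p * ∑ i, |w i - t i| := by
    rw [Finset.mul_sum]
    refine Finset.sum_congr rfl fun i _ => ?_
    rw [Pi.smul_apply, smul_eq_mul, mul_comm (t i), ← mul_sub, abs_mul, abs_of_pos hp]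
  calc |h.toFun (p • w) - h.toFun t * p| = p * |h.toFun w - h.toFun t| := by
        rw [h.map_smul p w hp.le, mul_comm _ p, ← mul_sub, abs_mul, abs_of_pos hp]
    _ ≤ p * (ε + M * ∑ i, |w i - t i|) := by
        gcongr
        exact (unit_ball w hw).trans (by gcongr; exact dist_le_sum_abs_sub w t)
    _ = ε * p + M * ∑ i, |(p • w) i - t i * p| := by rw [homogeneous_sum]; ring

variable {X : Type*} {l : Filter X}

/-- The pointwise value of `h` at a tuple of germs, computed on chosen representatives. -/
noncomputable def germ (α : Fin m → Germ l ℝ) : Germ l ℝ :=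
  ((fun x => h.toFun fun i => Quotient.out (α i) x : X → ℝ) : Germ l ℝ)

theorem germ_coe (f : Fin m → X → ℝ) :
    h.germ (fun i => (f i : Germ l ℝ)) =
      ((fun x => h.toFun fun i => f i x : X → ℝ) : Germ l ℝ) := by
  have representatives : ∀ i, Quotient.out (f i : Germ l ℝ) =ᶠ[l] f i :=
    fun i => Quotient.mk_out (s := l.germSetoid ℝ) (f i)
  refine Germ.coe_eq.2 ?_
  filter_upwards [eventually_all.2 representatives] with x hx
  exact congrArg h.toFun (funext hx)

theorem exists_abs_germ_sub_smul_le (t : Fin m → ℝ) {ε : ℝ} (hε : 0 < ε) :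
    ∃ M : ℝ, 0 ≤ M ∧ ∀ (α : Fin m → Germ l ℝ) (π : Germ l ℝ), (∀ i, |α i| ≤ π) → 0 ≤ π →
      |h.germ α - h.toFun t • π| ≤ ε • π + M • ∑ i, |α i - t i • π| := by
  obtain ⟨M, hM, hb⟩ := h.exists_abs_sub_mul_le t hε
  refine ⟨M, hM, fun α π hα hπ => ?_⟩
  obtain ⟨f, rfl⟩ : ∃ f : Fin m → X → ℝ, α = fun i => (f i : Germ l ℝ) :=
    ⟨fun i => Quotient.out (α i), funext fun i => (Quotient.out_eq (α i)).symm⟩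
  induction π using Germ.inductionOn with | _ p => ?_
  have sum_coe : ∑ i, |(f i : Germ l ℝ) - t i • (p : Germ l ℝ)| =
      ((fun x => ∑ i, |f i x - t i * p x| : X → ℝ) : Germ l ℝ) := by
    rw [← Finset.sum_fn]
    exact (map_sum (Germ.coeAddHom l) (fun i x => |f i x - t i * p x|) _).symm
  rw [germ_coe, sum_coe]
  refine Germ.coe_le.2 ?_
  filter_upwards [eventually_all.2 fun i => Germ.coe_le.1 (hα i), Germ.coe_le.1 hπ] with x hx hpx
  exact hb (fun i => f i x) (p x) hx hpx

theorem exists_abs_germ_le :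
    ∃ K : ℝ, 0 ≤ K ∧ ∀ α : Fin m → Germ l ℝ, |h.germ α| ≤ K • ∑ i, |α i| := by
  obtain ⟨M, hM, hb⟩ := h.exists_abs_germ_sub_smul_le (l := l) 0 one_pos
  refine ⟨1 + M, by positivity, fun α => ?_⟩
  have := hb α (∑ i, |α i|)
    (fun i => Finset.single_le_sum (f := fun i => |α i|) (fun _ _ => abs_nonneg _)
      (Finset.mem_univ i)) (Finset.sum_nonneg fun _ _ => abs_nonneg _)
  simpa only [h.map_zero, zero_smul, sub_zero, Pi.zero_apply, add_smul] using this

end PosHomFun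

section GermCalculus

variable {m : ℕ} {X : Type*} {l : Filter X}

-- If `ω (α i) = t i * ω π` for all `i`, then `ω` annihilates the sum in the bound for `h.germ α`.
theorem IsLatticeHomOn.apply_germ_eq_mul (h : PosHomFun m) {ω : Germ l ℝ → ℝ}
    {L : VectorSublattice (Germ l ℝ)} (hω : IsLatticeHomOn ω L) {α : Fin m → Germ l ℝ}
    {π : Germ l ℝ} (hα : ∀ i, α i ∈ L) (hL : h.germ α ∈ L) (hπ : π ∈ L) (hαπ : ∀ i, |α i| ≤ π)
    (hπ0 : 0 ≤ π) {t : Fin m → ℝ} (ht : ∀ i, ω (α i) = t i * ω π) :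
    ω (h.germ α) = h.toFun t * ω π := by
  have smul_mem : ∀ r : ℝ, r • π ∈ L := fun r => SMulMemClass.smul_mem r hπ
  have diff_mem : ∀ i, α i - t i • π ∈ L := fun i => sub_mem (hα i) (smul_mem _)
  have sum_mem : ∑ i, |α i - t i • π| ∈ L := sum_mem fun i _ => L.abs_mem (diff_mem i)
  have map_sum_eq_zero : ω (∑ i, |α i - t i • π|) = 0 := by
    rw [hω.map_sum _ fun i => L.abs_mem (diff_mem i)]
    refine Finset.sum_eq_zero fun i _ => ?_
    rw [hω.map_abs (diff_mem i), hω.map_sub (hα i) (smul_mem _), hω.map_smul _ _ hπ, ht i,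
      smul_eq_mul, sub_self, abs_zero]
  have hωπ : 0 ≤ ω π := by
    rw [← hω.map_zero]
    exact hω.map_le L.zero_mem hπ hπ0
  rw [← sub_eq_zero, ← abs_nonpos_iff]
  refine le_of_forall_pos_le_add fun ε hε => ?_
  obtain ⟨M, -, hM⟩ := h.exists_abs_germ_sub_smul_le (l := l) t
    (show 0 < ε / (ω π + 1) by positivity)
  have := hω.map_le (L.abs_mem (sub_mem hL (smul_mem _)))
    (add_mem (smul_mem _) (SMulMemClass.smul_mem _ sum_mem)) (hM α π hαπ hπ0)
  rw [hω.map_abs (sub_mem hL (smul_mem _)), hω.map_sub hL (smul_mem _), hω.map_smul _ _ hπ,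
    hω.map_add _ (smul_mem _) _ (SMulMemClass.smul_mem _ sum_mem), hω.map_smul _ _ hπ,
    hω.map_smul _ _ sum_mem, map_sum_eq_zero, smul_zero, add_zero] at this
  calc |ω (h.germ α) - h.toFun t * ω π| ≤ ε / (ω π + 1) * ω π := this
    _ ≤ ε / (ω π + 1) * (ω π + 1) := by gcongr; linarith
    _ = 0 + ε := by rw [div_mul_cancel₀ _ (by positivity), zero_add]

theorem IsLatticeHomOn.apply_germ (h : PosHomFun m) {ω : Germ l ℝ → ℝ}
    {L : VectorSublattice (Germ l ℝ)} (hω : IsLatticeHomOn ω L) {α : Fin m → Germ l ℝ}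
    (hα : ∀ i, α i ∈ L) (hL : h.germ α ∈ L) : ω (h.germ α) = h.toFun fun i => ω (α i) := by
  set π := ∑ i, |α i|
  have hπ : π ∈ L := sum_mem fun i _ => L.abs_mem (hα i)
  have hπ0 : 0 ≤ π := Finset.sum_nonneg fun _ _ => abs_nonneg _
  have hαπ : ∀ i, |α i| ≤ π := fun i =>
    Finset.single_le_sum (f := fun i => |α i|) (fun _ _ => abs_nonneg _) (Finset.mem_univ i)
  have hωπ : 0 ≤ ω π := by
    rw [← hω.map_zero]
    exact hω.map_le L.zero_mem hπ hπ0
  have abs_map_le : ∀ i, |ω (α i)| ≤ ω π := fun i => by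
    rw [← hω.map_abs (hα i)]
    exact hω.map_le (L.abs_mem (hα i)) hπ (hαπ i)
  have proportional : ∀ i, ω (α i) = ω (α i) / ω π * ω π := fun i =>
    (div_mul_cancel_of_imp fun h0 => abs_nonpos_iff.1 ((abs_map_le i).trans h0.le)).symm
  rw [hω.apply_germ_eq_mul h hα hL hπ hαπ hπ0 proportional, mul_comm, ← h.map_smul _ _ hωπ]
  refine congrArg h.toFun (funext fun i => ?_)
  rw [Pi.smul_apply, smul_eq_mul, mul_comm, ← proportional i]

variable [CountableInterFilter l] {G : Type*} [AddCommGroup G] [Lattice G] [Module ℝ G]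

theorem HasValue.map_eq_germ {h : PosHomFun m} {a : Fin m → G} {b : G}
    (hv : HasValue h a b) {ψ : G → Germ l ℝ} {L : VectorSublattice G} (hψ : IsLatticeHomOn ψ L)
    (ha : ∀ i, a i ∈ L) (hb : b ∈ L) : ψ b = h.germ fun i => ψ (a i) := by
  set γ := h.germ fun i => ψ (a i)
  by_contra hne
  have hpos : 0 < |ψ b - γ| := (abs_nonneg _).lt_of_ne fun h0 =>
    hne (sub_eq_zero.1 (abs_eq_zero_iff_of_lattice.1 h0.symm))
  let C : Set (Germ l ℝ) := insert |ψ b - γ| (insert γ (insert (ψ b) (Set.range fun i => ψ (a i))))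
  have hC : C.Countable := (((Set.countable_range _).insert _).insert _).insert _
  obtain ⟨ω, hω, hω1⟩ := exists_isLatticeHomOn_generated_eq_one hC (Set.mem_insert _ _) hpos
  have hγC : γ ∈ VectorSublattice.generated C := VectorSublattice.subset_generated C (by simp [C])
  have hbC : ψ b ∈ VectorSublattice.generated C := VectorSublattice.subset_generated C (by simp [C])
  have haC : ∀ i, ψ (a i) ∈ VectorSublattice.generated C := fun i =>
    VectorSublattice.subset_generated C (by simp [C])
  have hωψ : IsLatticeHomOn (ω ∘ ψ) (hψ.preimage (VectorSublattice.generated C)) :=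
    hω.comp (hψ.mono fun x hx => hx.1) fun x hx => hx.2
  have value_b : ω (ψ b) = h.toFun fun i => ω (ψ (a i)) :=
    hv.apply_eq hωψ (fun i => ⟨ha i, haC i⟩) ⟨hb, hbC⟩
  have value_γ : ω γ = h.toFun fun i => ω (ψ (a i)) := hω.apply_germ h haC hγC
  rw [hω.map_abs (sub_mem hbC hγC), hω.map_sub hbC hγC, value_b, value_γ, sub_self,
    abs_zero] at hω1
  exact zero_ne_one hω1

theorem HasValue.exists_abs_le [ArchimedeanVectorLattice G] (h : PosHomFun m) :
    ∃ K : ℝ, 0 ≤ K ∧ ∀ (a : Fin m → G) (b : G), HasValue h a b → |b| ≤ K • ∑ i, |a i| := by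
  obtain ⟨K, hK, bound⟩ := h.exists_abs_germ_le (l := evalFilter G)
  refine ⟨K, hK, fun a b hv => VLHom.le_of_map_le evalGerm_injective ?_⟩
  have value_b := hv.map_eq_germ ((evalGerm G).isLatticeHomOn ⊤)
    (fun _ => VectorSublattice.mem_top _) (VectorSublattice.mem_top b)
  simp only [VLHom.map_abs, map_smul, map_sum, value_b]
  exact bound _

end GermCalculus

/-! ### Induction over the stages of the functional completion -/

section Stages

variable {E G : Type*} [AddCommGroup E] [Lattice E] [Module ℝ E]
  [AddCommGroup G] [Lattice G] [Module ℝ G] {D : Set AnyPosHomFun} {φ : VLHom E G}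

theorem functionalCompletion_subset {Q : VectorSublattice G} (hφ : ∀ x, φ x ∈ Q)
    (hQ : ∀ h ∈ D, ∀ (a : Fin h.1 → G) (b : G), (∀ i, a i ∈ Q) →
      (∀ i, a i ∈ functionalCompletion D φ) → b ∈ functionalCompletion D φ →
      HasValue h.2 a b → b ∈ Q) : (functionalCompletion D φ : Set G) ⊆ Q := by
  rintro x ⟨n, hn⟩
  induction n generalizing x with
  | zero => obtain ⟨y, rfl⟩ := hn; exact hφ y
  | succ n ih =>
    refine VectorSublattice.generated_subset ?_ hn
    rintro b (hb | ⟨h, hh, a, ha, hv⟩)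
    · exact ih hb
    · exact hQ h hh a b (fun i => ih (ha i)) (fun i => ⟨n, ha i⟩)
        ⟨n + 1, VectorSublattice.subset_generated _ (Or.inr ⟨h, hh, a, ha, hv⟩)⟩ hv

theorem map_mem_functionalCompletion (x : E) : φ x ∈ functionalCompletion D φ := ⟨0, x, rfl⟩

section Domination

variable [ArchimedeanVectorLattice E] [ArchimedeanVectorLattice G]

/-- The ideal generated by the image of `φ`, as a vector sublattice. -/
def VLHom.rangeIdeal (φ : VLHom E G) : VectorSublattice G where
  carrier := {x | ∃ e : E, 0 ≤ e ∧ |x| ≤ φ e}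
  add_mem' := by
    rintro x y ⟨e, he, hxe⟩ ⟨f, hf, hyf⟩
    refine ⟨e + f, add_nonneg he hf, ?_⟩
    rw [map_add]
    exact (abs_add_le x y).trans (add_le_add hxe hyf)
  zero_mem' := ⟨0, le_rfl, by rw [map_zero, abs_zero]⟩
  smul_mem' := by
    rintro r x ⟨e, he, hxe⟩
    refine ⟨|r| • e, smul_nonneg (abs_nonneg r) he, ?_⟩
    rw [map_smul, abs_smul_of_lattice]
    gcongr
  sup_mem' := by
    rintro x y ⟨e, he, hxe⟩ ⟨f, -, hyf⟩
    refine ⟨e ⊔ f, he.trans le_sup_left, ?_⟩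
    rw [SupHomClass.map_sup]
    refine sup_le (sup_le_sup ((le_abs_self x).trans hxe) ((le_abs_self y).trans hyf)) ?_
    rw [neg_sup]
    exact inf_le_left.trans (((neg_le_abs x).trans hxe).trans le_sup_left)
  inf_mem' := by
    rintro x y ⟨e, he, hxe⟩ ⟨f, -, hyf⟩
    refine ⟨e ⊔ f, he.trans le_sup_left, ?_⟩
    rw [SupHomClass.map_sup]
    refine sup_le (inf_le_left.trans (((le_abs_self x).trans hxe).trans le_sup_left)) ?_
    rw [neg_inf]
    exact sup_le_sup ((neg_le_abs x).trans hxe) ((neg_le_abs y).trans hyf)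

theorem exists_abs_le_toFunctionalCompletion (x : functionalCompletion D φ) :
    ∃ e : E, 0 ≤ e ∧ |x| ≤ toFunctionalCompletion D φ e := by
  refine functionalCompletion_subset (Q := φ.rangeIdeal)
    (fun x => ⟨|x|, abs_nonneg x, (VLHom.map_abs φ x).ge⟩) (fun h _ a b ha _ _ hv => ?_) x.2
  choose e he hae using ha
  obtain ⟨K, hK, bound⟩ := HasValue.exists_abs_le (G := G) h.2
  refine ⟨K • ∑ i, e i, smul_nonneg hK (Finset.sum_nonneg fun i _ => he i), ?_⟩
  calc |b| ≤ K • ∑ i, |a i| := bound a b hv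
    _ ≤ K • ∑ i, φ (e i) := by gcongr with i; exact hae i
    _ = φ (K • ∑ i, e i) := by rw [map_smul, map_sum]

/-- A positive element of `E` whose image dominates a given element of the functional
completion. -/
noncomputable def dominator (x : functionalCompletion D φ) : E :=
  (exists_abs_le_toFunctionalCompletion x).choose

theorem dominator_nonneg (x : functionalCompletion D φ) : 0 ≤ dominator x :=
  (exists_abs_le_toFunctionalCompletion x).choose_spec.1

theorem abs_le_toFunctionalCompletion_dominator (x : functionalCompletion D φ) :
    |x| ≤ toFunctionalCompletion D φ (dominator x) :=
  (exists_abs_le_toFunctionalCompletion x).choose_spec.2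

end Domination

variable {X : Type*} {l : Filter X} [CountableInterFilter l]

theorem eq_of_eq_toFunctionalCompletion {ψ ψ' : VLHom (functionalCompletion D φ) (Germ l ℝ)}
    (h : ∀ x, ψ (toFunctionalCompletion D φ x) = ψ' (toFunctionalCompletion D φ x))
    (x : functionalCompletion D φ) : ψ x = ψ' x := by
  have hψ := IsLatticeHomOn.extendZero ψ
  have hψ' := IsLatticeHomOn.extendZero ψ'
  have subset_eqLocus : (functionalCompletion D φ : Set G) ⊆ hψ.eqLocus hψ' := by
    refine functionalCompletion_subset (fun y => ⟨map_mem_functionalCompletion y, ?_⟩)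
      fun f _ a b ha haB hb hv => ⟨hb, ?_⟩
    · simp only [VectorSublattice.extendZero_apply _ _ (map_mem_functionalCompletion y)]
      exact h y
    · rw [hv.map_eq_germ hψ haB hb, hv.map_eq_germ hψ' haB hb]
      exact congrArg f.2.germ (funext fun i => (ha i).2)
  simpa only [VectorSublattice.extendZero_apply _ _ x.2] using (subset_eqLocus x.2).2

theorem map_mem_range_of_isFunctionallyComplete {F : Type*} [AddCommGroup F] [Lattice F]
    [Module ℝ F] (hF : IsFunctionallyComplete D F) (J : VLHom F (Germ l ℝ))
    (ψ : VLHom (functionalCompletion D φ) (Germ l ℝ))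
    (h : ∀ x, ψ (toFunctionalCompletion D φ x) ∈ J.range) (x : functionalCompletion D φ) :
    ψ x ∈ J.range := by
  have hψ := IsLatticeHomOn.extendZero ψ
  have subset_preimage : (functionalCompletion D φ : Set G) ⊆ hψ.preimage J.range := by
    refine functionalCompletion_subset (fun y => ⟨map_mem_functionalCompletion y, ?_⟩)
      fun f hf a b ha haB hb hv => ⟨hb, ?_⟩
    · simp only [VectorSublattice.extendZero_apply _ _ (map_mem_functionalCompletion y)]
      exact h y
    · choose c hc using fun i => (ha i).2
      replace hc : ∀ i, J (c i) = _ := hc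
      obtain ⟨d, hd⟩ := hF f hf c
      refine ⟨d, ?_⟩
      rw [hv.map_eq_germ hψ haB hb, ← funext hc]
      exact hd.map_eq_germ (J.isLatticeHomOn ⊤) (fun i => VectorSublattice.mem_top _)
        (VectorSublattice.mem_top d)
  simpa only [VectorSublattice.extendZero_apply _ _ x.2] using (subset_preimage x.2).2

end Stages

/-! ### Multimorphisms -/

theorem forall_of_forall_update {ι : Type*} [Finite ι] [DecidableEq ι] {B : ι → Type*}
    {p : (∀ k, B k) → Prop} {A C : ∀ k, Set (B k)} (base : ∀ x, (∀ k, x k ∈ A k) → p x)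
    (step : ∀ k x, (∀ j, x j ∈ A j ∪ C j) → x k ∈ C k →
      (∀ a ∈ A k, p (Function.update x k a)) → p x)
    (x : ∀ k, B k) (hx : ∀ k, x k ∈ C k) : p x := by
  cases nonempty_fintype ι
  suffices ∀ (J : Finset ι) (x : ∀ k, B k), (∀ k ∈ J, x k ∈ C k) → (∀ k ∉ J, x k ∈ A k) → p x from
    this Finset.univ x (fun k _ => hx k) fun k hk => (hk (Finset.mem_univ k)).elim
  intro J
  induction J using Finset.induction_on with
  | empty => exact fun x _ hA => base x fun k => hA k (Finset.notMem_empty k)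
  | insert k J hk ih =>
    intro x hC hA
    refine step k x (fun j => ?_) (hC k (Finset.mem_insert_self k J)) fun a ha =>
      ih _ (fun j hj => ?_) fun j hj => ?_
    · by_cases hj : j ∈ insert k J
      · exact Or.inr (hC j hj)
      · exact Or.inl (hA j hj)
    · rw [Function.update_of_ne (ne_of_mem_of_not_mem hj hk)]
      exact hC j (Finset.mem_insert_of_mem hj)
    · obtain rfl | hjk := eq_or_ne j k
      · rwa [Function.update_self]
      · rw [Function.update_of_ne hjk]
        exact hA j (by simp only [Finset.mem_insert, hjk, hj, or_self, not_false_eq_true])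

section MultilinearInduction

variable {ι : Type*} {B : ι → Type*} [∀ k, AddCommGroup (B k)]
  [∀ k, Lattice (B k)] [∀ k, IsOrderedAddMonoid (B k)] [∀ k, Module ℝ (B k)]
  {M : Type*} [AddCommGroup M] [Module ℝ M] {S : MultilinearMap ℝ B M} {N : Submodule ℝ M}

theorem multilinear_mem_of_update_posPart_negPart [DecidableEq ι] {x : ∀ k, B k} {k : ι}
    (hpos : S (Function.update x k (x k)⁺) ∈ N) (hneg : S (Function.update x k (x k)⁻) ∈ N) :
    S x ∈ N := by
  have := N.sub_mem hpos hneg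
  rwa [← S.map_update_sub, posPart_sub_negPart, Function.update_eq_self] at this

theorem multilinear_mem_of_forall_nonneg [Finite ι] (h : ∀ x : ∀ k, B k, 0 ≤ x → S x ∈ N)
    (x : ∀ k, B k) : S x ∈ N := by
  classical
  exact forall_of_forall_update (A := fun k => Set.Ici (0 : B k)) (C := fun _ => Set.univ) h
    (fun k x _ _ hk => multilinear_mem_of_update_posPart_negPart (hk _ (posPart_nonneg (x k)))
      (hk _ (negPart_nonneg (x k)))) x fun _ => trivial

theorem multilinear_mem_of_forall_mem [Finite ι] [DecidableEq ι] {L : ∀ k, VectorSublattice (B k)}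
    (base : ∀ x : ∀ k, B k, (∀ k, x k ∈ L k) → S x ∈ N)
    (step : ∀ (k : ι) (x : ∀ k, B k), 0 ≤ x → (∀ a ∈ L k, S (Function.update x k a) ∈ N) →
      ∀ b, S (Function.update x k b) ∈ N) (x : ∀ k, B k) : S x ∈ N := by
  refine multilinear_mem_of_forall_nonneg (forall_of_forall_update
    (A := fun k => {a | a ∈ L k ∧ 0 ≤ a}) (C := fun k => Set.Ici (0 : B k))
    (fun x hx => base x fun k => (hx k).1) fun k x hx _ hk => ?_) x
  have hx0 : 0 ≤ x := fun j => (hx j).elim And.right id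
  rw [← Function.update_eq_self k x]
  refine step k x hx0 (fun a ha => multilinear_mem_of_update_posPart_negPart (k := k) ?_ ?_) _ <;>
    rw [Function.update_self, Function.update_idem]
  · exact hk _ ⟨(L k).sup_mem ha (zero_mem _), posPart_nonneg a⟩
  · exact hk _ ⟨(L k).sup_mem (neg_mem ha) (zero_mem _), negPart_nonneg a⟩

end MultilinearInduction

namespace IsVLMultimorphism

variable {s : ℕ} {E : Fin s → Type*} {F H : Type*}
  [∀ k, AddCommGroup (E k)] [∀ k, Lattice (E k)] [∀ k, Module ℝ (E k)]
  [AddCommGroup F] [Lattice F] [Module ℝ F] [AddCommGroup H] [Lattice H] [Module ℝ H]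
  {T : MultilinearMap ℝ E F} {e f : ∀ k, E k}

/-- The homomorphism obtained from a multimorphism by fixing all variables but one at positive
elements. -/
def slice (hT : IsVLMultimorphism T) (he : 0 ≤ e) (k : Fin s) : VLHom (E k) F :=
  ⟨T.toLinearMap e k, hT k e fun j _ => he j⟩

theorem slice_apply (hT : IsVLMultimorphism T) (he : 0 ≤ e) (k : Fin s) (x : E k) :
    hT.slice he k x = T (Function.update e k x) := rfl

theorem of_forall_nonneg
    (h : ∀ (k : Fin s) (x : ∀ j, E j), 0 ≤ x → IsLatticeHom (T.toLinearMap x k)) :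
    IsVLMultimorphism T := by
  intro k x hx
  have := h k (Function.update x k 0) (le_update_iff.2 ⟨le_rfl, hx⟩)
  simpa only [IsLatticeHom, MultilinearMap.toLinearMap_apply, Function.update_idem] using this

theorem exists_factor {U : MultilinearMap ℝ E H} (hU : IsVLMultimorphism U) {J : VLHom F H}
    (hJ : Function.Injective J) (hUJ : ∀ x, U x ∈ J.range) :
    ∃ S : MultilinearMap ℝ E F, IsVLMultimorphism S ∧ ∀ x, J (S x) = U x := by
  choose S hS using hUJ
  replace hS : ∀ x, J (S x) = U x := hS
  refine ⟨.mk' S (fun x i a b => hJ ?_) (fun x i r a => hJ ?_), fun k x hx a b => ?_, hS⟩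
  · rw [map_add, hS, hS, hS, U.map_update_add]
  · rw [map_smul, hS, hS, U.map_update_smul]
  · have hsup := (hU k x hx a b).1
    have hinf := (hU k x hx a b).2
    simp only [MultilinearMap.toLinearMap_apply, ← hS] at hsup hinf
    rw [← SupHomClass.map_sup] at hsup
    rw [← InfHomClass.map_inf] at hinf
    exact ⟨hJ hsup, hJ hinf⟩

theorem map_nonneg (hT : IsVLMultimorphism T) (k : Fin s) (hf : 0 ≤ f) : 0 ≤ T f := by
  rw [← Function.update_eq_self k f, ← hT.slice_apply hf]
  exact _root_.map_nonneg _ (hf k)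

theorem map_le (hT : IsVLMultimorphism T) (hf : 0 ≤ f) (hfe : f ≤ e) : T f ≤ T e := by
  refine forall_of_forall_update (p := fun x => T f ≤ T x) (A := fun k => {f k})
    (C := fun k => {e k}) (fun x hx => (congrArg T (funext hx)).ge) (fun k x hx hxk hk => ?_) e
    fun _ => rfl
  have hx0 : 0 ≤ x := fun j => (hx j).elim (fun h => (hf j).trans_eq h.symm)
    fun h => ((hf j).trans (hfe j)).trans_eq h.symm
  refine (hk (f k) rfl).trans ?_
  conv_rhs => rw [← Function.update_eq_self k x, show x k = e k from hxk]
  rw [← hT.slice_apply hx0, ← hT.slice_apply hx0]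
  exact OrderHomClass.mono _ (hfe k)

end IsVLMultimorphism

/-! ### The product formula -/

section GermIdentities

variable {X : Type*} {l : Filter X}

instance : IsScalarTower ℝ (Germ l ℝ) (Germ l ℝ) where
  smul_assoc r a b := Germ.inductionOn₂ a b fun f g =>
    Germ.coe_eq.2 (.of_forall fun x => mul_assoc r (f x) (g x))

theorem germ_inv_nonneg {t : Germ l ℝ} : 0 ≤ t → 0 ≤ t⁻¹ :=
  Germ.inductionOn t fun _ ht => Germ.coe_nonneg.2 <|
    (Germ.coe_nonneg.1 ht).mono fun _ => inv_nonneg.2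

/-- Multiplication on the right by a positive germ. -/
def germMulRight (c : Germ l ℝ) (hc : 0 ≤ c) : VLHom (Germ l ℝ) (Germ l ℝ) where
  toLin :=
    { toFun := (· * c)
      map_add' := fun a b => add_mul a b c
      map_smul' := fun r a => smul_mul_assoc r a c }
  isLatticeHom a b := by
    induction c using Germ.inductionOn with | _ g =>
    induction a, b using Germ.inductionOn₂ with | _ f f' =>
    exact ⟨Germ.coe_eq.2 ((Germ.coe_nonneg.1 hc).mono fun x => max_mul_of_nonneg (f x) (f' x)),
      Germ.coe_eq.2 ((Germ.coe_nonneg.1 hc).mono fun x => min_mul_of_nonneg (f x) (f' x))⟩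

theorem germMulRight_apply (c : Germ l ℝ) (hc : 0 ≤ c) (a : Germ l ℝ) :
    germMulRight c hc a = a * c := rfl

theorem germ_eq_mul_mul_inv {a b d t : Germ l ℝ} (ha : 0 ≤ a) (hat : a ≤ t)
    (h : a * t = b * d) : a = b * (d * t⁻¹) := by
  induction a, t using Germ.inductionOn₂ with | _ a t =>
  induction b, d using Germ.inductionOn₂ with | _ b d =>
  refine Germ.coe_eq.2 ?_
  filter_upwards [Germ.coe_nonneg.1 ha, Germ.coe_le.1 hat, Germ.coe_eq.1 h] with x hax hatx hx
  change a x = b x * (d x * (t x)⁻¹)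
  obtain ht | ht := (hax.trans hatx).eq_or_lt'
  · rw [ht, inv_zero, mul_zero, mul_zero]
    exact hax.antisymm' (hatx.trans_eq ht)
  · rw [← mul_assoc, eq_mul_inv_iff_mul_eq₀ ht.ne']
    exact hx

/-- The identity that makes the product formula independent of the dominating elements: `p` and
`p'` are the values of the slices at the two families of dominating elements. -/
theorem mul_prod_mul_inv_eq {ι : Type*} [Fintype ι] {p p' d : ι → ℝ} {t t' : ℝ}
    (hp : ∀ k, p k * d k = p' k * t) (ht : t = t' * ∏ k, (d k * t'⁻¹))
    (hpd : ∀ k, |p' k| ≤ d k) : t * ∏ k, (p k * t⁻¹) = t' * ∏ k, (p' k * t'⁻¹) := by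
  obtain rfl | ht' := eq_or_ne t' 0
  · rw [ht, zero_mul, zero_mul, zero_mul]
  by_cases hd : ∃ k, d k = 0
  · obtain ⟨k, hk⟩ := hd
    have hpk : p' k = 0 := abs_nonpos_iff.1 ((hpd k).trans_eq hk)
    rw [ht, Finset.prod_eq_zero (Finset.mem_univ k) (by rw [hk, zero_mul]),
      Finset.prod_eq_zero (i := k) (f := fun k => p' k * t'⁻¹) (Finset.mem_univ k)
        (by rw [hpk, zero_mul]), mul_zero, zero_mul]
  push Not at hd
  have ht0 : t ≠ 0 := by
    rw [ht]
    exact mul_ne_zero ht'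
      (Finset.prod_ne_zero_iff.2 fun k _ => mul_ne_zero (hd k) (inv_ne_zero ht'))
  calc t * ∏ k, (p k * t⁻¹)
      = t' * (∏ k, (d k * t'⁻¹)) * ∏ k, (p' k * (d k)⁻¹) := by
        rw [← ht]
        congr! 2 with k
        rw [mul_inv_eq_iff_eq_mul₀ ht0, mul_right_comm, eq_mul_inv_iff_mul_eq₀ (hd k), hp]
    _ = t' * ∏ k, (p' k * t'⁻¹) := by
        rw [mul_assoc, ← Finset.prod_mul_distrib]
        congr! 2 with k
        field_simp [hd k]

theorem germ_mul_prod_mul_inv_eq {ι : Type*} [Fintype ι] {p p' d : ι → Germ l ℝ}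
    {t t' : Germ l ℝ} (hp : ∀ k, p k * d k = p' k * t) (ht : t = t' * ∏ k, (d k * t'⁻¹))
    (hpd : ∀ k, |p' k| ≤ d k) : t * ∏ k, (p k * t⁻¹) = t' * ∏ k, (p' k * t'⁻¹) := by
  have coe_prod (q : ι → X → ℝ) (r : X → ℝ) : (r : Germ l ℝ) * ∏ k, ((q k : Germ l ℝ) * (↑r)⁻¹) =
      ((fun x => r x * ∏ k, (q k x * (r x)⁻¹) : X → ℝ) : Germ l ℝ) := by
    trans ((r * ∏ k, (q k * r⁻¹) : X → ℝ) : Germ l ℝ)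
    · exact congrArg ((r : Germ l ℝ) * ·)
        (map_prod (Germ.coeMulHom (M := ℝ) l) _ _).symm
    · refine congrArg _ (funext fun x => ?_)
      simp only [Pi.mul_apply, Finset.prod_apply, Pi.inv_apply]
  choose P hP using fun k => Quotient.exists_rep (p k)
  choose P' hP' using fun k => Quotient.exists_rep (p' k)
  choose d' hd' using fun k => Quotient.exists_rep (d k)
  obtain rfl : (fun k => (P k : Germ l ℝ)) = p := funext hP
  obtain rfl : (fun k => (P' k : Germ l ℝ)) = p' := funext hP'
  obtain rfl : (fun k => (d' k : Germ l ℝ)) = d := funext hd'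
  induction t, t' using Germ.inductionOn₂ with | _ t t' =>
  simp only [coe_prod] at ht ⊢
  refine Germ.coe_eq.2 ?_
  filter_upwards [eventually_all.2 fun k => Germ.coe_eq.1 (hp k), Germ.coe_eq.1 ht,
    eventually_all.2 fun k => Germ.coe_le.1 (hpd k)] with x hpx htx hpdx
  exact mul_prod_mul_inv_eq hpx htx hpdx

end GermIdentities

section Proportionality

variable {F : Type*} [AddCommGroup F] [Lattice F] [Module ℝ F]

theorem VLHom.mul_comm_of_abs_le {p q p' q' : F}
    (h : ∀ r t : ℝ, |r • p + t • q| ≤ |r • p' + t • q'|) (ω : VLHom F ℝ) :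
    ω p * ω q' = ω q * ω p' := by
  have := OrderHomClass.mono ω (h (ω q') (-ω p'))
  simp only [VLHom.map_abs, map_add, map_smul, smul_eq_mul] at this
  rw [show ω q' * ω p' + -ω p' * ω q' = 0 by ring, abs_zero, abs_nonpos_iff] at this
  linear_combination this

theorem evalGerm_mul_comm_of_abs_le {p q p' q' : F}
    (h : ∀ r t : ℝ, |r • p + t • q| ≤ |r • p' + t • q'|) :
    evalGerm F p * evalGerm F q' = evalGerm F q * evalGerm F p' := by
  refine Germ.coe_eq.2 ?_
  have countable : ({p, q, p', q'} : Set F).Countable := (Set.toFinite _).countable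
  filter_upwards [eventually_isLatticeHomOn_generated countable] with ω hω
  have mem {x : F} (hx : x ∈ ({p, q, p', q'} : Set F)) := VectorSublattice.subset_generated _ hx
  exact hω.toVLHom.mul_comm_of_abs_le (p := ⟨p, mem (by simp)⟩) (q := ⟨q, mem (by simp)⟩)
    (p' := ⟨p', mem (by simp)⟩) (q' := ⟨q', mem (by simp)⟩) h

end Proportionality

namespace IsVLMultimorphism

variable {s : ℕ} {E : Fin s → Type*} {F : Type*}
  [∀ k, AddCommGroup (E k)] [∀ k, Lattice (E k)] [∀ k, Module ℝ (E k)]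
  [∀ k, IsOrderedAddMonoid (E k)]
  [AddCommGroup F] [Lattice F] [Module ℝ F] {T : MultilinearMap ℝ E F} {e f : ∀ k, E k}

theorem evalGerm_slice_mul (hT : IsVLMultimorphism T) (hf : 0 ≤ f) (hfe : f ≤ e) (k : Fin s)
    (x y : E k) :
    evalGerm F (T (Function.update f k x)) * evalGerm F (T (Function.update e k y)) =
      evalGerm F (T (Function.update f k y)) * evalGerm F (T (Function.update e k x)) := by
  refine evalGerm_mul_comm_of_abs_le fun r t => ?_
  simp only [← hT.slice_apply hf, ← hT.slice_apply (hf.trans hfe), ← map_smul, ← map_add,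
    ← VLHom.map_abs]
  simp only [slice_apply]
  exact hT.map_le (le_update_iff.2 ⟨abs_nonneg _, fun j _ => hf j⟩)
    (update_le_update_iff.2 ⟨le_rfl, fun j _ => hfe j⟩)

theorem evalGerm_piecewise (hT : IsVLMultimorphism T) (hf : 0 ≤ f) (hfe : f ≤ e)
    (J : Finset (Fin s)) :
    evalGerm F (T (J.piecewise f e)) = evalGerm F (T e) *
      ∏ k ∈ J, (evalGerm F (T (Function.update e k (f k))) * (evalGerm F (T e))⁻¹) := by
  induction J using Finset.induction_on with
  | empty => rw [Finset.piecewise_empty, Finset.prod_empty, mul_one]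
  | insert k J hk ih =>
    have he : 0 ≤ e := hf.trans hfe
    have hg : 0 ≤ J.piecewise f e := J.le_piecewise_of_le_of_le hf he
    have hge : J.piecewise f e ≤ e := J.piecewise_le_of_le_of_le hfe le_rfl
    have hgk : Function.update (J.piecewise f e) k (e k) = J.piecewise f e :=
      Function.update_eq_self_iff.2 (J.piecewise_eq_of_notMem f e hk).symm
    have hins : (insert k J).piecewise f e = Function.update (J.piecewise f e) k (f k) :=
      J.piecewise_insert f e k
    have slice_mul := hT.evalGerm_slice_mul hg hge k (f k) (e k)
    rw [hgk, Function.update_eq_self, ← hins] at slice_mul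
    have h0 : 0 ≤ (insert k J).piecewise f e := Finset.le_piecewise_of_le_of_le _ hf he
    have hle : (insert k J).piecewise f e ≤ e := Finset.piecewise_le_of_le_of_le _ hfe le_rfl
    rw [germ_eq_mul_mul_inv (_root_.map_nonneg _ (hT.map_nonneg k h0))
      (OrderHomClass.mono _ (hT.map_le h0 hle)) slice_mul, ih, Finset.prod_insert hk]
    ring

theorem evalGerm_eq_mul_prod (hT : IsVLMultimorphism T) (hf : 0 ≤ f) (hfe : f ≤ e) :
    evalGerm F (T f) = evalGerm F (T e) *
      ∏ k, (evalGerm F (T (Function.update e k (f k))) * (evalGerm F (T e))⁻¹) := by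
  simpa only [Finset.piecewise_univ] using hT.evalGerm_piecewise hf hfe Finset.univ

end IsVLMultimorphism

/-! ### Extension of multimorphisms -/

section Extension

variable {s : ℕ} {E G : Fin s → Type*} {F : Type*}
  [∀ k, AddCommGroup (E k)] [∀ k, Lattice (E k)] [∀ k, Module ℝ (E k)]
  [∀ k, AddCommGroup (G k)] [∀ k, Lattice (G k)] [∀ k, Module ℝ (G k)]
  [AddCommGroup F] [Lattice F] [Module ℝ F]
  {T : MultilinearMap ℝ E F} {D : Set AnyPosHomFun} {φ : ∀ k, VLHom (E k) (G k)}
  {e f : ∀ k, E k}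

/-- The map `toFunctionalCompletion` as a vector lattice homomorphism. -/
def toFunctionalCompletionHom {E G : Type*} [AddCommGroup E] [Lattice E] [Module ℝ E]
    [AddCommGroup G] [Lattice G] [Module ℝ G] (D : Set AnyPosHomFun) (φ : VLHom E G) :
    VLHom E (functionalCompletion D φ) where
  toLin :=
    { toFun := toFunctionalCompletion D φ
      map_add' := fun x y => Subtype.ext (map_add φ x y)
      map_smul' := fun r x => Subtype.ext (map_smul φ r x) }
  isLatticeHom x y := ⟨Subtype.ext (φ.isLatticeHom x y).1, Subtype.ext (φ.isLatticeHom x y).2⟩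

namespace IsVLMultimorphism

/-- The extension of a slice of a multimorphism to the functional completion, with values in
germs; `ψ` represents the functional completions by germs. -/
def sliceExt (hT : IsVLMultimorphism T)
    (ψ : ∀ k, VLHom (functionalCompletion D (φ k)) (Germ (evalFilter (E k)) ℝ)) (he : 0 ≤ e)
    (k : Fin s) : VLHom (functionalCompletion D (φ k)) (Germ (evalFilter F) ℝ) :=
  (germMap (hT.slice he k)).comp (ψ k)

/-- The value at `x` of the extension of a multimorphism according to the product formula, valid
wherever `e` dominates `x`. -/
noncomputable def localExt (hT : IsVLMultimorphism T)
    (ψ : ∀ k, VLHom (functionalCompletion D (φ k)) (Germ (evalFilter (E k)) ℝ)) (he : 0 ≤ e)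
    (x : ∀ k, functionalCompletion D (φ k)) : Germ (evalFilter F) ℝ :=
  evalGerm F (T e) * ∏ k, (hT.sliceExt ψ he k (x k) * (evalGerm F (T e))⁻¹)

/-- The factor by which `localExt` differs from `sliceExt` as a function of the `i`th variable. -/
noncomputable def localFactor (hT : IsVLMultimorphism T)
    (ψ : ∀ k, VLHom (functionalCompletion D (φ k)) (Germ (evalFilter (E k)) ℝ)) (he : 0 ≤ e)
    (x : ∀ k, functionalCompletion D (φ k)) (i : Fin s) : Germ (evalFilter F) ℝ :=
  evalGerm F (T e) * (evalGerm F (T e))⁻¹ *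
    ∏ k ∈ Finset.univ.erase i, (hT.sliceExt ψ he k (x k) * (evalGerm F (T e))⁻¹)

variable {ψ : ∀ k, VLHom (functionalCompletion D (φ k)) (Germ (evalFilter (E k)) ℝ)}

theorem localExt_update (hT : IsVLMultimorphism T) (he : 0 ≤ e)
    (x : ∀ k, functionalCompletion D (φ k)) (i : Fin s) (a : functionalCompletion D (φ i)) :
    hT.localExt ψ he (Function.update x i a) =
      hT.sliceExt ψ he i a * hT.localFactor ψ he x i := by
  have prod_erase : ∏ k ∈ Finset.univ.erase i,
      (hT.sliceExt ψ he k (Function.update x i a k) * (evalGerm F (T e))⁻¹) =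
      ∏ k ∈ Finset.univ.erase i, (hT.sliceExt ψ he k (x k) * (evalGerm F (T e))⁻¹) :=
    Finset.prod_congr rfl fun k hk => by rw [Function.update_of_ne (Finset.ne_of_mem_erase hk)]
  rw [localExt, localFactor, ← Finset.mul_prod_erase _ _ (Finset.mem_univ i), prod_erase,
    Function.update_self]
  ring

variable (hψ : ∀ k x, ψ k (toFunctionalCompletion D (φ k) x) = evalGerm (E k) x)

include hψ in
theorem sliceExt_toFunctionalCompletion (hT : IsVLMultimorphism T) (he : 0 ≤ e) (k : Fin s)
    (x : E k) : hT.sliceExt ψ he k (toFunctionalCompletion D (φ k) x) =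
      evalGerm F (T (Function.update e k x)) := by
  rw [sliceExt, VLHom.comp_apply, hψ, germMap_evalGerm, slice_apply]

theorem localFactor_nonneg (hT : IsVLMultimorphism T) (he : 0 ≤ e)
    {x : ∀ k, functionalCompletion D (φ k)} (hx : 0 ≤ x) (i : Fin s) :
    0 ≤ hT.localFactor ψ he x i := by
  have ht : 0 ≤ evalGerm F (T e) := _root_.map_nonneg _ (hT.map_nonneg i he)
  have hinv : 0 ≤ (evalGerm F (T e))⁻¹ := germ_inv_nonneg ht
  exact mul_nonneg (mul_nonneg ht hinv)
    (Finset.prod_nonneg fun k _ => mul_nonneg (_root_.map_nonneg _ (hx k)) hinv)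

variable [∀ k, ArchimedeanVectorLattice (E k)]

include hψ in
theorem localExt_toFunctionalCompletion (hT : IsVLMultimorphism T) (he : 0 ≤ e) (hf : 0 ≤ f)
    (hfe : f ≤ e) :
    hT.localExt ψ he (fun k => toFunctionalCompletion D (φ k) (f k)) = evalGerm F (T f) := by
  simp only [localExt, hT.sliceExt_toFunctionalCompletion hψ, hT.evalGerm_eq_mul_prod hf hfe]

include hψ in
theorem sliceExt_mul (hT : IsVLMultimorphism T) (he : 0 ≤ e) {e' : ∀ k, E k} (hee' : e ≤ e')
    (k : Fin s) (x : functionalCompletion D (φ k)) :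
    hT.sliceExt ψ he k x * evalGerm F (T (Function.update e' k (e k))) =
      hT.sliceExt ψ (he.trans hee') k x * evalGerm F (T e) := by
  have hd : 0 ≤ evalGerm F (T (Function.update e' k (e k))) := _root_.map_nonneg _
    (hT.map_nonneg k (le_update_iff.2 ⟨he k, fun j _ => (he.trans hee') j⟩))
  have ht : 0 ≤ evalGerm F (T e) := _root_.map_nonneg _ (hT.map_nonneg k he)
  refine eq_of_eq_toFunctionalCompletion (ψ := (germMulRight _ hd).comp (hT.sliceExt ψ he k))
    (ψ' := (germMulRight _ ht).comp (hT.sliceExt ψ (he.trans hee') k)) (fun y => ?_) x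
  rw [VLHom.comp_apply, VLHom.comp_apply, germMulRight_apply, germMulRight_apply,
    hT.sliceExt_toFunctionalCompletion hψ, hT.sliceExt_toFunctionalCompletion hψ,
    hT.evalGerm_slice_mul he hee', Function.update_eq_self, mul_comm]

include hψ in
theorem localExt_eq_of_le (hT : IsVLMultimorphism T) (he : 0 ≤ e) {e' : ∀ k, E k}
    (hee' : e ≤ e') {x : ∀ k, functionalCompletion D (φ k)}
    (hx : ∀ k, |x k| ≤ toFunctionalCompletion D (φ k) (e k)) :
    hT.localExt ψ he x = hT.localExt ψ (he.trans hee') x := by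
  refine germ_mul_prod_mul_inv_eq (fun k => hT.sliceExt_mul hψ he hee' k (x k))
    (hT.evalGerm_eq_mul_prod he hee') fun k => ?_
  rw [← VLHom.map_abs, ← hT.sliceExt_toFunctionalCompletion hψ (he.trans hee')]
  exact OrderHomClass.mono _ (hx k)

variable [∀ k, ArchimedeanVectorLattice (G k)]

/-- The extension of a multimorphism to the functional completions, with values in germs. -/
noncomputable def germExt (hT : IsVLMultimorphism T)
    (ψ : ∀ k, VLHom (functionalCompletion D (φ k)) (Germ (evalFilter (E k)) ℝ))
    (x : ∀ k, functionalCompletion D (φ k)) : Germ (evalFilter F) ℝ :=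
  hT.localExt ψ (fun k => dominator_nonneg (x k)) x

include hψ in
theorem germExt_eq_localExt (hT : IsVLMultimorphism T) (he : 0 ≤ e)
    {x : ∀ k, functionalCompletion D (φ k)} (hx : (fun k => dominator (x k)) ≤ e) :
    hT.germExt ψ x = hT.localExt ψ he x :=
  hT.localExt_eq_of_le hψ _ hx fun k => abs_le_toFunctionalCompletion_dominator (x k)

include hψ in
theorem exists_germExt_update_eq (hT : IsVLMultimorphism T)
    (x : ∀ k, functionalCompletion D (φ k)) (i : Fin s) {K : Set (functionalCompletion D (φ i))}
    (hK : K.Finite) : ∃ (e : ∀ k, E k) (he : 0 ≤ e), ∀ y ∈ K,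
      hT.germExt ψ (Function.update x i y) =
        hT.sliceExt ψ he i y * hT.localFactor ψ he x i := by
  have bdd : BddAbove (insert 0
      ((fun y => fun k => dominator (Function.update x i y k)) '' K)) :=
    ((hK.image _).insert 0).bddAbove
  obtain ⟨e, he⟩ := bdd
  refine ⟨e, he (Set.mem_insert 0 _), fun y hy => ?_⟩
  rw [← localExt_update]
  exact hT.germExt_eq_localExt hψ _ (he (Set.mem_insert_of_mem _ (Set.mem_image_of_mem _ hy)))

/-- `germExt` as a multilinear map. -/
noncomputable def germExtMultilinear (hT : IsVLMultimorphism T) :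
    MultilinearMap ℝ (fun k => functionalCompletion D (φ k)) (Germ (evalFilter F) ℝ) :=
  .mk' (hT.germExt ψ)
    (fun x i a b => by
      obtain ⟨e, he, h⟩ := hT.exists_germExt_update_eq hψ x i (Set.toFinite {a, b, a + b})
      rw [h a (by simp), h b (by simp), h (a + b) (by simp), map_add, add_mul])
    (fun x i r a => by
      obtain ⟨e, he, h⟩ := hT.exists_germExt_update_eq hψ x i (Set.toFinite {a, r • a})
      rw [h a (by simp), h (r • a) (by simp), map_smul, smul_mul_assoc])

theorem germExtMultilinear_isVLMultimorphism (hT : IsVLMultimorphism T) :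
    IsVLMultimorphism (hT.germExtMultilinear hψ) := by
  refine of_forall_nonneg fun i x hx a b => ?_
  obtain ⟨e, he, h⟩ := hT.exists_germExt_update_eq hψ x i (Set.toFinite {a, b, a ⊔ b, a ⊓ b})
  let Ψ := (germMulRight _ (hT.localFactor_nonneg (ψ := ψ) he hx i)).comp (hT.sliceExt ψ he i)
  have eq_Ψ : ∀ y ∈ ({a, b, a ⊔ b, a ⊓ b} : Set _),
      (hT.germExtMultilinear hψ).toLinearMap x i y = Ψ y := h
  rw [eq_Ψ a (by simp), eq_Ψ b (by simp), eq_Ψ (a ⊔ b) (by simp), eq_Ψ (a ⊓ b) (by simp)]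
  exact Ψ.isLatticeHom a b

theorem germExtMultilinear_toFunctionalCompletion (hT : IsVLMultimorphism T) (f : ∀ k, E k) :
    hT.germExtMultilinear hψ (fun k => toFunctionalCompletion D (φ k) (f k)) =
      evalGerm F (T f) := by
  let U := (hT.germExtMultilinear hψ).compLinearMap
    fun k => (toFunctionalCompletionHom D (φ k)).toLin
  let V := (evalGerm F).toLin.compMultilinearMap T
  suffices (U - V) f ∈ (⊥ : Submodule ℝ (Germ (evalFilter F) ℝ)) from sub_eq_zero.1 this
  refine multilinear_mem_of_forall_nonneg (fun f hf => sub_eq_zero.2 ?_) f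
  let d := fun k => dominator (toFunctionalCompletion D (φ k) (f k))
  have hd : 0 ≤ d ⊔ f := hf.trans le_sup_right
  exact (hT.germExt_eq_localExt hψ hd le_sup_left).trans
    (hT.localExt_toFunctionalCompletion hψ hd hf le_sup_right)

theorem germExtMultilinear_mem_range (hT : IsVLMultimorphism T)
    (hF : IsFunctionallyComplete D F) (x : ∀ k, functionalCompletion D (φ k)) :
    hT.germExtMultilinear hψ x ∈ (evalGerm F).range := by
  refine multilinear_mem_of_forall_mem (N := (evalGerm F).range.toSubmodule)
    (L := fun k => (toFunctionalCompletionHom D (φ k)).range) (fun x hx => ?_)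
    (fun k x hx hk b => ?_) x
  · choose f hf using hx
    obtain rfl : (fun k => toFunctionalCompletion D (φ k) (f k)) = x := funext hf
    exact ⟨T f, (hT.germExtMultilinear_toFunctionalCompletion hψ f).symm⟩
  · exact map_mem_range_of_isFunctionallyComplete hF (evalGerm F)
      ((hT.germExtMultilinear_isVLMultimorphism hψ).slice hx k) (fun a => hk _ ⟨a, rfl⟩) b

variable [ArchimedeanVectorLattice F]

include hψ in
theorem exists_extension (hT : IsVLMultimorphism T) (hF : IsFunctionallyComplete D F) :
    ∃ S : MultilinearMap ℝ (fun k => functionalCompletion D (φ k)) F, IsVLMultimorphism S ∧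
      ∀ f : ∀ k, E k, S (fun k => toFunctionalCompletion D (φ k) (f k)) = T f := by
  obtain ⟨S, hS, hSU⟩ := (hT.germExtMultilinear_isVLMultimorphism hψ).exists_factor
    evalGerm_injective (hT.germExtMultilinear_mem_range hψ hF)
  exact ⟨S, hS, fun f => evalGerm_injective <|
    (hSU _).trans (hT.germExtMultilinear_toFunctionalCompletion hψ f)⟩

end IsVLMultimorphism

theorem IsVLMultimorphism.eq_of_eq_toFunctionalCompletion [∀ k, ArchimedeanVectorLattice (G k)]
    [ArchimedeanVectorLattice F]
    {S S' : MultilinearMap ℝ (fun k => functionalCompletion D (φ k)) F}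
    (hS : IsVLMultimorphism S) (hS' : IsVLMultimorphism S')
    (h : ∀ f : ∀ k, E k, S (fun k => toFunctionalCompletion D (φ k) (f k)) =
      S' (fun k => toFunctionalCompletion D (φ k) (f k))) : S = S' := by
  ext x
  suffices (S - S') x ∈ (⊥ : Submodule ℝ F) from sub_eq_zero.1 this
  refine multilinear_mem_of_forall_mem (L := fun k => (toFunctionalCompletionHom D (φ k)).range)
    (fun x hx => sub_eq_zero.2 ?_) (fun k x hx hk b => sub_eq_zero.2 ?_) x
  · choose f hf using hx
    obtain rfl : (fun k => toFunctionalCompletion D (φ k) (f k)) = x := funext hf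
    exact h f
  · exact evalGerm_injective <| _root_.eq_of_eq_toFunctionalCompletion
      (ψ := (evalGerm F).comp (hS.slice hx k)) (ψ' := (evalGerm F).comp (hS'.slice hx k))
      (fun y => congrArg (evalGerm F) (sub_eq_zero.1 (hk _ ⟨y, rfl⟩))) b

end Extension

theorem theorem3p18_general {s : ℕ} (E : Fin s → Type u)
    [∀ k, AddCommGroup (E k)] [∀ k, Lattice (E k)] [∀ k, Module ℝ (E k)]
    [∀ k, ArchimedeanVectorLattice (E k)]
    (F : Type v) [AddCommGroup F] [Lattice F] [Module ℝ F] [ArchimedeanVectorLattice F]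
    (D : Set AnyPosHomFun) (hF : IsFunctionallyComplete D F)
    (T : MultilinearMap ℝ E F) (hT : IsVLMultimorphism T) :
    (∀ k, ∃ (G : Type u) (_ : AddCommGroup G) (_ : Lattice G) (_ : Module ℝ G)
      (φ : VLHom (E k) G), IsUniformCompletion φ) ∧
    ∀ (G : Fin s → Type u) [∀ k, AddCommGroup (G k)] [∀ k, Lattice (G k)] [∀ k, Module ℝ (G k)]
      (φ : ∀ k, VLHom (E k) (G k)), (∀ k, IsUniformCompletion (φ k)) →
        ∃! S : MultilinearMap ℝ (fun k => functionalCompletion D (φ k)) F,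
          IsVLMultimorphism S ∧
          ∀ f : ∀ k, E k, S (fun k => toFunctionalCompletion D (φ k) (f k)) = T f := by
  refine ⟨fun k => ⟨_, _, _, _, _, isUniformCompletion_toUniformCompletion (E k)⟩,
    fun G _ _ _ φ hφ => ?_⟩
  have := fun k => (hφ k).archimedean
  choose ι hι _ using fun k =>
    (hφ k).existsUnique_extension _ isUniformlyComplete_germ (evalGerm (E k))
  obtain ⟨S, hS, hST⟩ := hT.exists_extension
    (ψ := fun k => (ι k).comp (functionalCompletion D (φ k)).incl) hι hF
  exact ⟨S, ⟨hS, hST⟩, fun S' hS' =>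
    hS'.1.eq_of_eq_toFunctionalCompletion hS fun f => (hS'.2 f).trans (hST f).symm⟩

theorem theorem3p18 {s : ℕ} (hs : 1 ≤ s) (E : Fin s → Type u)
    [∀ k, AddCommGroup (E k)] [∀ k, Lattice (E k)] [∀ k, Module ℝ (E k)]
    [∀ k, ArchimedeanVectorLattice (E k)]
    (F : Type v) [AddCommGroup F] [Lattice F] [Module ℝ F] [ArchimedeanVectorLattice F]
    (D : Set AnyPosHomFun) (hD : D.Nonempty) (hF : IsFunctionallyComplete D F)
    (T : MultilinearMap ℝ E F) (hT : IsVLMultimorphism T) :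
    -- every `E k` has a uniform completion
    (∀ k, ∃ (G : Type u) (_ : AddCommGroup G) (_ : Lattice G) (_ : Module ℝ G)
      (φ : VLHom (E k) G), IsUniformCompletion φ) ∧
    -- and, inside any uniform completions `G k` of the `E k`:
    ∀ (G : Fin s → Type u) [∀ k, AddCommGroup (G k)] [∀ k, Lattice (G k)] [∀ k, Module ℝ (G k)]
      (φ : ∀ k, VLHom (E k) (G k)), (∀ k, IsUniformCompletion (φ k)) →
      ((∀ h ∈ D, h.2.AbsolutelyInvariant) →
        ∃! S : MultilinearMap ℝ (fun k => functionalCompletion D (φ k)) F,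
          IsVLMultimorphism S ∧
          ∀ f : ∀ k, E k, S (fun k => toFunctionalCompletion D (φ k) (f k)) = T f) ∧
      (s = 1 →
        ∃! S : MultilinearMap ℝ (fun k => functionalCompletion D (φ k)) F,
          IsVLMultimorphism S ∧
          ∀ f : ∀ k, E k, S (fun k => toFunctionalCompletion D (φ k) (f k)) = T f) :=
  have ⟨h, h'⟩ := theorem3p18_general E F D hF T hT
  ⟨h, fun G _ _ _ φ hφ => ⟨fun _ => h' G φ hφ, fun _ => h' G φ hφ⟩⟩
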